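/- Let $N\in\mathbb N$ and $p\in\mathbb R$ with $1<p<N$, and put $p^*=\frac{Np}{N-p}$. Consider the lattice graph on $\mathbb Z^N$, where $x\sim y$ iff $\sum_{i=1}^N|x_i-y_i|=1$, and for $u:\mathbb Z^N\to\mathbb R$ let $\Delta_pu(x)=\sum_{y\sim x}|u(y)-u(x)|^{p-2}(u(y)-u(x))$. Let $V:\mathbb Z^N\to\mathbb R$ and $f:\mathbb Z^N\times\mathbb R\to\mathbb R$, put $F(x,t)=\int_0^tf(x,s)\,ds$, and assume: (S1) for some integer $T\ge1$, $V(x+Te_i)=V(x)$ and $f(x+Te_i,t)=f(x,t)$ for all $x\in\mathbb Z^N$, $1\le i\le N$, $t\in\mathbb R$, and $V\ge0$; (S2) $f(x,\cdot)$ is continuous for every $x$, and there are $a>0$ and $q>p^*$ with $f(x,t)\le a(1+|t|^{q-1})$ for all $x,t$; (S3) $f(x,t)=o(|t|^{p^*-1})$ as $|t|\to0$, uniformly in $x$; (S4) for every $x$, $t\mapsto f(x,t)/|t|^{p-1}$ is strictly increasing on $(-\infty,0)\cup(0,\infty)$; (S5) $F(x,t)/|t|^p\to\infty$ as $|t|\to\infty$,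 uniformly in $x$. Let $E$ be the completion of the space of finitely supported functions $u:\mathbb Z^N\to\mathbb R$ with respect to the norm $$\|u\|=\Big(\sum_{x\sim y}\tfrac12|u(y)-u(x)|^p+\sum_{x}V(x)|u(x)|^p\Big)^{1/p}$$ (the first sum being over ordered pairs), realized as a space of functions on $\mathbb Z^N$ by taking pointwise limits of Cauchy sequences. For $u,v\in E$ let $\Phi(u)=\frac1p\|u\|^p-\sum_xF(x,u(x))$ and $$\langle\Phi'(u),v\rangle=\sum_{x\sim y}\tfrac12|u(y)-u(x)|^{p-2}(u(y)-u(x))(v(y)-v(x))+\sum_xV(x)|u(x)|^{p-2}u(x)v(x)-\sum_xf(x,u(x))v(x),$$ and let $\mathcal N=\{u\in E\setminus\{0\}:\langle\Phi'(u),u\rangle=0\}$. A ground state is a $u\in\mathcal N$ with $\Phi(u)=\inf_{\mathcal N}\Phi$. Then a ground state exists, and every ground state $u$ is a solution of $$-\Delta_pu(x)+V(x)|u(x)|^{p-2}u(x)=f(x,u(x)),\qquad x\in\mathbb Z^N,\quad u\in E.$$ Moreover, if $F(x,t)\le F(x,|t|)$ for all $(x,t)\in\mathbb Z^N\times\mathbb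 R$, then every ground state $u$ satisfies either $u(x)>0$ for all $x$ or $u(x)<0$ for all $x$. -/

import Mathlib

open Filter Topology

namespace LatticePLaplace

/-- The integer lattice graph on `ℤ^N`: `x ∼ y` iff `∑ |x i - y i| = 1`. -/
def lattice (N : ℕ) : SimpleGraph (Fin N → ℤ) where
  Adj x y := ∑ i, |x i - y i| = 1
  symm := ⟨fun x y h => by simpa only [abs_sub_comm] using h⟩
  loopless := ⟨fun x h => by simp at h⟩

/-- `h` is `T`-periodic: `h (x + T e_i) = h x` for all `x` and all `i`. -/
def IsPeriodic {N : ℕ} {β : Type*} (T : ℕ) (h : (Fin N → ℤ) → β) : Prop :=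
  ∀ (x : Fin N → ℤ) (i : Fin N), h (x + Pi.single i (T : ℤ)) = h x

noncomputable section

/-- The critical exponent `p^* = N p / (N - p)`. -/
def pStar (N : ℕ) (p : ℝ) : ℝ := N * p / (N - p)

/-- The discrete `p`-Laplacian
`Δ_p u (x) = ∑_{y ∼ x} |u y - u x|^(p-2) (u y - u x)`.
Each vertex has finitely many neighbours, so the sum is finite. -/
def pLaplacian {N : ℕ} (p : ℝ) (u : (Fin N → ℤ) → ℝ) (x : Fin N → ℤ) : ℝ :=
  ∑' y : (lattice N).neighborSet x, |u y - u x| ^ (p - 2) * (u y - u x)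

/-- `∑_{x ∼ y} (1/2) |u y - u x|^p + ∑_x V x |u x|^p`. The first sum runs over ordered pairs of
adjacent vertices, which are the darts of the graph. -/
def normPow {N : ℕ} (p : ℝ) (V : (Fin N → ℤ) → ℝ) (u : (Fin N → ℤ) → ℝ) : ℝ :=
  (∑' d : (lattice N).Dart, (1 / 2) * |u d.snd - u d.fst| ^ p) + ∑' x, V x * |u x| ^ p

/-- The norm `‖u‖`. -/
def eNorm {N : ℕ} (p : ℝ) (V : (Fin N → ℤ) → ℝ) (u : (Fin N → ℤ) → ℝ) : ℝ :=
  normPow p V u ^ (1 / p)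

/-- The space `E`, the completion of the finitely supported functions `C_c(ℤ^N)` with respect to
`‖·‖`, realized as a space of functions: its elements are the pointwise limits of `‖·‖`-Cauchy
sequences in `C_c(ℤ^N)`. For `1 ≤ p < N` and `V ≥ 0` every Cauchy sequence converges pointwise
(Sobolev inequality), and two Cauchy sequences have the same pointwise limit if and only if their
difference tends to `0` in norm, so this is the completion. -/
def E {N : ℕ} (p : ℝ) (V : (Fin N → ℤ) → ℝ) : Set ((Fin N → ℤ) → ℝ) :=
  {u | ∃ w : ℕ → (Fin N → ℤ) → ℝ,
    (∀ n, (Function.support (w n)).Finite) ∧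
    (∀ ε > 0, ∃ n₀, ∀ m ≥ n₀, ∀ n ≥ n₀, eNorm p V (w m - w n) < ε) ∧
    ∀ x, Tendsto (fun n => w n x) atTop (𝓝 (u x))}

/-- The primitive `F (x, t) = ∫_0^t f (x, s) ds`. -/
def primitive {N : ℕ} (f : (Fin N → ℤ) → ℝ → ℝ) (x : Fin N → ℤ) (t : ℝ) : ℝ :=
  ∫ s in (0 : ℝ)..t, f x s

/-- The energy functional `Φ(u) = (1/p) ‖u‖^p - ∑_x F (x, u x)`. -/
def energy {N : ℕ} (p : ℝ) (V : (Fin N → ℤ) → ℝ) (f : (Fin N → ℤ) → ℝ → ℝ)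
    (u : (Fin N → ℤ) → ℝ) : ℝ :=
  (1 / p) * normPow p V u - ∑' x, primitive f x (u x)

/-- The derivative pairing `⟨Φ'(u), v⟩`. -/
def energyDeriv {N : ℕ} (p : ℝ) (V : (Fin N → ℤ) → ℝ) (f : (Fin N → ℤ) → ℝ → ℝ)
    (u v : (Fin N → ℤ) → ℝ) : ℝ :=
  (∑' d : (lattice N).Dart, (1 / 2) *
      (|u d.snd - u d.fst| ^ (p - 2) * (u d.snd - u d.fst) * (v d.snd - v d.fst)))
    + (∑' x, V x * |u x| ^ (p - 2) * u x * v x) - ∑' x, f x (u x) * v x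

/-- The Nehari manifold `{u ∈ E \ {0} : ⟨Φ'(u), u⟩ = 0}`. -/
def nehari {N : ℕ} (p : ℝ) (V : (Fin N → ℤ) → ℝ) (f : (Fin N → ℤ) → ℝ → ℝ) :
    Set ((Fin N → ℤ) → ℝ) :=
  {u | u ∈ E p V ∧ u ≠ 0 ∧ energyDeriv p V f u u = 0}

/-- A ground state: an element of the Nehari manifold at which `Φ` attains its infimum over the
Nehari manifold. -/
def IsGroundState {N : ℕ} (p : ℝ) (V : (Fin N → ℤ) → ℝ) (f : (Fin N → ℤ) → ℝ → ℝ)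
    (u : (Fin N → ℤ) → ℝ) : Prop :=
  u ∈ nehari p V f ∧ ∀ v ∈ nehari p V f, energy p V f u ≤ energy p V f v

/-- `u` solves `-Δ_p u + V |u|^(p-2) u = f (x, u)`, `u ∈ E`. -/
def IsSolution {N : ℕ} (p : ℝ) (V : (Fin N → ℤ) → ℝ) (f : (Fin N → ℤ) → ℝ → ℝ)
    (u : (Fin N → ℤ) → ℝ) : Prop :=
  u ∈ E p V ∧ ∀ x, -pLaplacian p u x + V x * |u x| ^ (p - 2) * u x = f x (u x)

end

end LatticePLaplace

/-! The ground state is found by direct minimisation on the Nehari manifold, with lattice periods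
compensating for the lack of compactness. A discrete Sobolev inequality (`sobolev`) bounds the
`ℓ^{p^*}` norm, hence the supremum norm, by the energy norm. It also identifies `E` with the
functions that vanish at infinity and have finite energy (`mem_E_iff`). Since elements of `E` are
bounded, local information on `f` together with its smallness at `0` controls every series.

Strict monotonicity of `f (x, t) / |t| ^ (p - 1)` gives pointwise inequalities along rays
(`Assumptions.fibering`). They imply that each `u` on the manifold is the strict maximum of `Φ` on
its ray, and that there `Φ` equals `∑ G (x, u x)` with `G = f t / p - F ≥ 0` (`gap`), which does not
increase when `u` is scaled down.

A minimising sequence is bounded (`exists_normPow_bound`) and does not vanish uniformly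
(`exists_lower_bound`). After translation by periods a subsequence has a nonzero pointwise limit
`u`. If `⟨Φ'(u), u⟩ ≤ 0`, then `u` scales down to the manifold and Fatou's lemma for `G` shows that
the result is a minimiser. Otherwise Brezis–Lieb splitting makes the remainder `w` satisfy `⟨Φ'(w),
w⟩ < 0` with `∑ G` below the infimum, and scaling `w` down contradicts minimality
(`exists_groundState`).

Since `f` is merely continuous, the manifold need not be smooth and Lagrange multipliers are
avoided. If the equation failed at one vertex, changing the value there in the descent direction and
rescaling back to the manifold by the intermediate value theorem would lower the energy
(`residual_eq_zero`). For the sign, `|u|` is again a ground state with the same gradient energy. A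
zero of `|u|` would spread to all neighbours through the equation, and a sign change across an edge
would make the gradient energy of `|u|` strictly smaller. -/

namespace LatticePLaplace

/-! ### Gagliardo–Nirenberg and Sobolev inequalities for finitely supported functions. -/

open MeasureTheory ENNReal in
/-- A finitely supported function on `ℤ` is bounded by its total variation. -/
lemma enorm_le_tsum_diff (g : ℤ → ℝ) (hg : (Function.support g).Finite) (k : ℤ) :
    ‖g k‖ₑ ≤ ∑' t : ℤ, ‖g (t + 1) - g t‖ₑ := by
  obtain ⟨B, hB⟩ := hg.bddAbove
  -- This point lies beyond `B` even when `k > B`, where `toNat` returns `0`.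
  have hz : g (k + ((B - k).toNat + 1 : ℕ)) = 0 := by
    by_contra h
    have := hB h
    push_cast at this
    have := Int.self_le_toNat (B - k)
    lia
  have htel : ∀ n : ℕ, ‖g k‖ₑ ≤ (∑ j ∈ Finset.range n, ‖g (k + j + 1) - g (k + j)‖ₑ)
      + ‖g (k + n)‖ₑ := by
    intro n
    induction n with
    | zero => simp
    | succ n ih =>
      rw [Finset.sum_range_succ]
      refine ih.trans ?_
      rw [add_assoc]
      gcongr
      have : g (k + n) = -(g (k + n + 1) - g (k + n)) + g (k + (n + 1 : ℕ)) := by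
        push_cast; rw [← add_assoc]; ring
      calc ‖g (k + n)‖ₑ = ‖-(g (k + n + 1) - g (k + n)) + g (k + (n + 1 : ℕ))‖ₑ := by rw [← this]
        _ ≤ ‖-(g (k + n + 1) - g (k + n))‖ₑ + ‖g (k + (n + 1 : ℕ))‖ₑ := enorm_add_le _ _
        _ = _ := by rw [enorm_neg]
  have h1 := htel ((B - k).toNat + 1)
  rw [hz, enorm_zero, add_zero] at h1
  refine h1.trans ((ENNReal.sum_le_tsum _).trans ?_)
  exact ENNReal.tsum_comp_le_tsum_of_injective (f := fun j : ℕ => k + (j : ℤ))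
    (fun a b h => by simpa using h) (fun t => ‖g (t + 1) - g t‖ₑ)

open MeasureTheory in
lemma pi_count_eq_count (N : ℕ) :
    Measure.pi (fun _ : Fin N => (Measure.count : Measure ℤ)) = Measure.count := by
  refine Measure.ext_of_singleton fun x => ?_
  rw [Measure.count_singleton, Measure.pi_singleton]
  simp

open MeasureTheory ENNReal in
/-- The discrete Gagliardo–Nirenberg inequality, in extended nonnegative reals. -/
lemma tsum_enorm_rpow_le (N : ℕ) (hN : 2 ≤ N) (v : (Fin N → ℤ) → ℝ)
    (hv : (Function.support v).Finite) :
    ∑' x, ‖v x‖ₑ ^ ((N : ℝ) / (N - 1)) ≤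
      (∑' x, ∑ i, ‖v (x + Pi.single i 1) - v x‖ₑ) ^ ((N : ℝ) / (N - 1)) := by
  have hN' : (1 : ℝ) < N := by exact_mod_cast hN
  have hconj : Real.HolderConjugate (Fintype.card (Fin N) : ℝ) ((N : ℝ) / (N - 1)) := by
    rw [Fintype.card_fin]
    exact Real.HolderConjugate.conjExponent hN'
  -- The grid-lines inequality behind the continuous Gagliardo–Nirenberg–Sobolev theorem holds for
  -- any product of σ-finite measures, in particular for counting measure.
  have key := lintegral_prod_lintegral_pow_le (ι := Fin N) (A := fun _ => ℤ)
    (fun _ => (Measure.count : Measure ℤ)) hconj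
    (f := fun x => ∑ i, ‖v (x + Pi.single i 1) - v x‖ₑ) (measurable_of_countable _)
  rw [pi_count_eq_count, lintegral_count, lintegral_count] at key
  refine le_trans (ENNReal.tsum_le_tsum fun x => ?_) key
  have hline : ∀ i : Fin N, ‖v x‖ₑ ≤
      ∫⁻ t, ∑ j, ‖v (Function.update x i t + Pi.single j 1) - v (Function.update x i t)‖ₑ
        ∂(Measure.count : Measure ℤ) := by
    intro i
    rw [lintegral_count]
    have h1 := enorm_le_tsum_diff (fun t => v (Function.update x i t))
      (hv.preimage (Function.update_injective x i).injOn) (x i)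
    simp only [Function.update_eq_self] at h1
    refine h1.trans (ENNReal.tsum_le_tsum fun t => ?_)
    have : Function.update x i (t + 1) = Function.update x i t + Pi.single i 1 := by
      ext j
      by_cases hj : j = i
      · subst hj; simp
      · simp [hj]
    rw [this]
    exact Finset.single_le_sum
      (f := fun j => ‖v (Function.update x i t + Pi.single j 1) - v (Function.update x i t)‖ₑ)
      (fun _ _ => zero_le) (Finset.mem_univ i)
  -- One factor per coordinate direction, each bounded by the variation along the line through `x`
  -- in that direction.
  calc ‖v x‖ₑ ^ ((N : ℝ) / (N - 1)) = ∏ i : Fin N, ‖v x‖ₑ ^ ((1 : ℝ) / (N - 1)) := by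
        rw [Finset.prod_const, Finset.card_univ, Fintype.card_fin, ← ENNReal.rpow_natCast,
          ← ENNReal.rpow_mul]
        congr 1; ring
    _ ≤ _ := by
        refine Finset.prod_le_prod' fun i _ => ?_
        rw [Fintype.card_fin]
        refine ENNReal.rpow_le_rpow (hline i) ?_
        have : (0 : ℝ) < N - 1 := by linarith
        positivity

lemma support_shift_finite {N : ℕ} {v : (Fin N → ℤ) → ℝ} (hv : (Function.support v).Finite)
    (e : Fin N → ℤ) : (Function.support fun x => v (x + e)).Finite :=
  hv.preimage (add_left_injective e).injOn

/-- The discrete Gagliardo–Nirenberg inequality. -/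
lemma tsum_abs_rpow_le (N : ℕ) (hN : 2 ≤ N) (v : (Fin N → ℤ) → ℝ)
    (hv : (Function.support v).Finite) :
    ∑' x, |v x| ^ ((N : ℝ) / (N - 1)) ≤
      (∑ i, ∑' x, |v (x + Pi.single i 1) - v x|) ^ ((N : ℝ) / (N - 1)) := by
  have hN' : (1 : ℝ) < N := by exact_mod_cast hN
  have hN1 : (0 : ℝ) < N - 1 := by linarith
  have hr : (0 : ℝ) < (N : ℝ) / (N - 1) := by positivity
  have key := tsum_enorm_rpow_le N hN v hv
  have hs : ∀ i : Fin N, Summable fun x => |v (x + Pi.single i 1) - v x| := fun i =>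
    summable_of_hasFiniteSupport <| ((support_shift_finite hv (Pi.single i 1)).union hv).subset <| by
      intro x hx
      by_contra h
      simp only [Set.mem_union, Function.mem_support, not_or, not_not] at h
      simp [h.1, h.2] at hx
  have hs2 : Summable fun x => |v x| ^ ((N : ℝ) / (N - 1)) :=
    summable_of_hasFiniteSupport <| hv.subset <| by
      intro x hx
      by_contra h
      simp only [Function.mem_support, not_not] at h
      simp [h, Real.zero_rpow hr.ne'] at hx
  have e1 : ∑' x, ‖v x‖ₑ ^ ((N : ℝ) / (N - 1)) =
      ENNReal.ofReal (∑' x, |v x| ^ ((N : ℝ) / (N - 1))) := by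
    rw [ENNReal.ofReal_tsum_of_nonneg (fun _ => by positivity) hs2]
    congr 1; ext x
    rw [Real.enorm_eq_ofReal_abs, ENNReal.ofReal_rpow_of_nonneg (abs_nonneg _) hr.le]
  have e2 : ∑' x, ∑ i, ‖v (x + Pi.single i 1) - v x‖ₑ =
      ENNReal.ofReal (∑ i, ∑' x, |v (x + Pi.single i 1) - v x|) := by
    rw [← Summable.tsum_finsetSum fun i _ => hs i,
      ENNReal.ofReal_tsum_of_nonneg (fun _ => by positivity) (summable_sum fun i _ => hs i)]
    congr 1; ext x
    rw [ENNReal.ofReal_sum_of_nonneg fun _ _ => abs_nonneg _]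
    simp only [Real.enorm_eq_ofReal_abs]
  have hnn : 0 ≤ ∑ i, ∑' x, |v (x + Pi.single i 1) - v x| :=
    Finset.sum_nonneg fun i _ => tsum_nonneg fun _ => abs_nonneg _
  rw [e1, e2, ENNReal.ofReal_rpow_of_nonneg hnn hr.le,
    ENNReal.ofReal_le_ofReal_iff (by positivity)] at key
  exact key

/-- The dart from `x` to `x + e_i`. -/
def coordDart {N : ℕ} (i : Fin N) (x : Fin N → ℤ) : (lattice N).Dart :=
  ⟨(x, x + Pi.single i 1), by
    change ∑ j, |x j - (x + Pi.single i 1 : Fin N → ℤ) j| = 1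
    rw [Finset.sum_eq_single i]
    · simp
    · intro j _ hj; simp [hj]
    · simp⟩

lemma coordDart_injective {N : ℕ} (i : Fin N) : Function.Injective (coordDart i) := by
  intro x y h
  have := congrArg (fun d : (lattice N).Dart => d.fst) h
  exact this

lemma neighborSet_finite {N : ℕ} (x : Fin N → ℤ) : ((lattice N).neighborSet x).Finite := by
  refine (Set.finite_Icc (x - 1) (x + 1)).subset fun y hy => ?_
  have hy' : ∑ i, |x i - y i| = 1 := hy
  have h : ∀ i, |x i - y i| ≤ 1 := fun i => by
    rw [← hy']
    exact Finset.single_le_sum (f := fun i => |x i - y i|) (fun _ _ => abs_nonneg _)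
      (Finset.mem_univ i)
  constructor <;> intro i <;> have := abs_le.1 (h i) <;> simp <;> lia

lemma darts_fst_finite {N : ℕ} {s : Set (Fin N → ℤ)} (hs : s.Finite) :
    {d : (lattice N).Dart | d.fst ∈ s}.Finite := by
  have h : (⋃ x ∈ s, (fun y => (x, y)) '' (lattice N).neighborSet x).Finite :=
    hs.biUnion fun x _ => (neighborSet_finite x).image _
  refine (h.preimage (SimpleGraph.Dart.toProd_injective (G := lattice N)).injOn).subset ?_
  intro d hd
  simp only [Set.mem_preimage, Set.mem_iUnion]
  exact ⟨d.fst, hd, d.snd, d.adj, rfl⟩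

lemma darts_snd_finite {N : ℕ} {s : Set (Fin N → ℤ)} (hs : s.Finite) :
    {d : (lattice N).Dart | d.snd ∈ s}.Finite :=
  Set.Finite.preimage (f := SimpleGraph.Dart.symm)
    SimpleGraph.Dart.symm_involutive.injective.injOn (darts_fst_finite hs)

lemma darts_touching_finite {N : ℕ} {s : Set (Fin N → ℤ)} (hs : s.Finite) :
    {d : (lattice N).Dart | d.fst ∈ s ∨ d.snd ∈ s}.Finite :=
  (darts_fst_finite hs).union (darts_snd_finite hs)

/-- Mean value theorem, with the maximum of the two powers replaced by their sum. It lets Hölder's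
inequality handle the differences of `|u| ^ γ`. -/
lemma abs_rpow_sub_le {r : ℝ} (hr : 1 ≤ r) {a b : ℝ} (ha : 0 ≤ a) (hb : 0 ≤ b) :
    |a ^ r - b ^ r| ≤ r * (a ^ (r - 1) + b ^ (r - 1)) * |a - b| := by
  wlog hab : b ≤ a generalizing a b
  · have := this hb ha (le_of_not_ge hab)
    rwa [abs_sub_comm, abs_sub_comm a b, add_comm (a ^ (r - 1))]
  rw [abs_of_nonneg (sub_nonneg.2 (Real.rpow_le_rpow hb hab (by linarith))),
    abs_of_nonneg (sub_nonneg.2 hab)]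
  rcases hab.eq_or_lt with rfl | hlt
  · simp
  have hcont : ContinuousOn (fun t : ℝ => t ^ r) (Set.Icc b a) :=
    (Real.continuous_rpow_const (by linarith)).continuousOn
  obtain ⟨c, hc, hc'⟩ := exists_hasDerivAt_eq_slope (fun t : ℝ => t ^ r)
    (fun t => r * t ^ (r - 1)) hlt hcont
    (fun t ht => Real.hasDerivAt_rpow_const (Or.inr hr))
  rw [eq_div_iff (by linarith)] at hc'
  rw [← hc']
  gcongr
  calc c ^ (r - 1) ≤ a ^ (r - 1) :=
        Real.rpow_le_rpow (hb.trans hc.1.le) hc.2.le (by linarith)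
    _ ≤ _ := le_add_of_nonneg_right (by positivity)


lemma pStar_pos_aux {N : ℕ} {p : ℝ} (hp : 1 < p) (hpN : p < N) :
    p < pStar N p ∧ 1 / p - 1 / (N : ℝ) = 1 / pStar N p := by
  have h1 : 0 < (N : ℝ) - p := by linarith
  have h2 : (0 : ℝ) < N := by linarith
  unfold pStar
  constructor
  · rw [lt_div_iff₀ h1]
    nlinarith
  · field_simp

/-- The unweighted gradient energy `∑_{x ∼ y} |u y - u x| ^ p / 2`. -/
noncomputable def gradPow {N : ℕ} (p : ℝ) (u : (Fin N → ℤ) → ℝ) : ℝ :=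
  ∑' d : (lattice N).Dart, (1 / 2) * |u d.snd - u d.fst| ^ p

lemma summable_grad_of_finite {N : ℕ} {p : ℝ} (hp : 0 < p) {u : (Fin N → ℤ) → ℝ}
    (hu : (Function.support u).Finite) :
    Summable fun d : (lattice N).Dart => |u d.snd - u d.fst| ^ p :=
  summable_of_hasFiniteSupport <| (darts_touching_finite hu).subset <| by
    intro d hd
    by_contra h
    simp only [Set.mem_ofPred_eq, Function.mem_support, not_or, not_not] at h
    simp [h.1, h.2, Real.zero_rpow hp.ne'] at hd

lemma tsum_coord_diff_le {N : ℕ} {p : ℝ} {u : (Fin N → ℤ) → ℝ}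
    (hu : Summable fun d : (lattice N).Dart => |u d.snd - u d.fst| ^ p) (i : Fin N) :
    (Summable fun x => |u (x + Pi.single i 1) - u x| ^ p) ∧
      ∑' x, |u (x + Pi.single i 1) - u x| ^ p ≤ 2 * gradPow p u := by
  have h1 := hu.comp_injective (coordDart_injective i)
  have h2 := tsum_comp_le_tsum_of_inj hu (fun _ => by positivity) (coordDart_injective i)
  refine ⟨h1, h2.trans (le_of_eq ?_)⟩
  rw [gradPow, tsum_mul_left]
  ring

/-- The discrete Sobolev inequality for finitely supported functions. -/
theorem sobolev_finite {N : ℕ} {p : ℝ} (hp : 1 < p) (hpN : p < N) :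
    ∃ K > 0, ∀ u : (Fin N → ℤ) → ℝ, (Function.support u).Finite →
      ∑' x, |u x| ^ pStar N p ≤ K * gradPow p u ^ (pStar N p / p) := by
  obtain ⟨hps, hps'⟩ := pStar_pos_aux hp hpN
  have hN1 : (1 : ℝ) < N := hp.trans hpN
  have hN : 2 ≤ N := by exact_mod_cast hN1
  have hNp : 0 < (N : ℝ) - p := by linarith
  have hN1' : (0 : ℝ) < N - 1 := by linarith
  have hp0 : 0 < p := by linarith
  have hps0 : 0 < pStar N p := hp0.trans hps
  -- The exponent for which both `γ N / (N - 1)` and `(γ - 1) q` equal `p^*`, where `q` is conjugate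
  -- to `p`. Thus the same sum `S` appears on both sides of the estimate.
  set γ : ℝ := p * (N - 1) / (N - p) with hγ
  have hγ1 : 1 ≤ γ := by
    rw [hγ, le_div_iff₀ hNp]; nlinarith
  have hγp : γ - 1 = N * (p - 1) / (N - p) := by rw [hγ]; field_simp; ring
  set q : ℝ := p / (p - 1) with hq
  have hq0 : 0 < q := div_pos hp0 (by linarith)
  have hconj : q.HolderConjugate p := (Real.HolderConjugate.conjExponent hp).symm
  have hγq : (γ - 1) * q = pStar N p := by
    have : p - 1 ≠ 0 := by linarith
    rw [hγp, hq, pStar]; field_simp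
  have hγN : γ * ((N : ℝ) / (N - 1)) = pStar N p := by
    rw [hγ, pStar]; field_simp
  have hγ1' : 0 < γ - 1 := by
    rw [hγp]; exact div_pos (mul_pos (by linarith) (by linarith)) hNp
  -- The first `2` counts the two Hölder terms, `N` the directions, and `2 ^ (1 / p)` undoes the
  -- weight `1 / 2` in `gradPow`.
  refine ⟨(2 * γ * N * 2 ^ (1 / p)) ^ pStar N p, by positivity, fun u hu => ?_⟩
  set S := ∑' x, |u x| ^ pStar N p with hS
  set D := gradPow p u with hD
  have hD0 : 0 ≤ D := tsum_nonneg fun _ => by positivity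
  have hS0 : 0 ≤ S := tsum_nonneg fun _ => by positivity
  have hsS : Summable fun x => |u x| ^ pStar N p :=
    summable_of_hasFiniteSupport <| hu.subset <| by
      intro x hx
      by_contra h
      simp only [Function.mem_support, not_not] at h
      simp [h, Real.zero_rpow hps0.ne'] at hx
  have hv : (Function.support fun x => |u x| ^ γ).Finite := hu.subset <| by
    intro x hx
    by_contra h
    simp only [Function.mem_support, not_not] at h
    simp [h, Real.zero_rpow (by linarith : γ ≠ 0)] at hx
  have h1 := tsum_abs_rpow_le N hN (fun x => |u x| ^ γ) hv
  have e1 : ∀ x, |(|u x| ^ γ)| ^ ((N : ℝ) / (N - 1)) = |u x| ^ pStar N p := fun x => by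
    rw [abs_of_nonneg (by positivity), ← Real.rpow_mul (abs_nonneg _), hγN]
  simp only [e1] at h1
  have hterm : ∀ i : Fin N, ∑' x, |(|u (x + Pi.single i 1)| ^ γ) - |u x| ^ γ| ≤
      2 * γ * (S ^ (1 / q) * (2 * D) ^ (1 / p)) := by
    intro i
    obtain ⟨g1, g2⟩ := tsum_coord_diff_le (summable_grad_of_finite hp0 hu) i
    have e2 : ∀ x : Fin N → ℤ, (|u x| ^ (γ - 1)) ^ q = |u x| ^ pStar N p := fun x => by
      rw [← Real.rpow_mul (abs_nonneg _), hγq]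
    have hsh : Summable fun x => |u (x + Pi.single i 1)| ^ pStar N p :=
      hsS.comp_injective (add_left_injective (Pi.single i 1))
    have hshe : ∑' x : Fin N → ℤ, |u (x + Pi.single i 1)| ^ pStar N p = S :=
      (Equiv.addRight (Pi.single i 1 : Fin N → ℤ)).tsum_eq fun x => |u x| ^ pStar N p
    have A1 := Real.summable_and_inner_le_Lp_mul_Lq_tsum_of_nonneg hconj
      (f := fun x => |u (x + Pi.single i 1)| ^ (γ - 1)) (g := fun x => |u (x + Pi.single i 1) - u x|)
      (fun _ => by positivity) (fun _ => by positivity) (by simpa only [e2] using hsh) g1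
    have A2 := Real.summable_and_inner_le_Lp_mul_Lq_tsum_of_nonneg hconj
      (f := fun x => |u x| ^ (γ - 1)) (g := fun x => |u (x + Pi.single i 1) - u x|)
      (fun _ => by positivity) (fun _ => by positivity) (by simpa only [e2] using hsS) g1
    simp only [e2, hshe] at A1 A2
    have g3 : (∑' x, |u (x + Pi.single i 1) - u x| ^ p) ^ (1 / p) ≤ (2 * D) ^ (1 / p) :=
      Real.rpow_le_rpow (tsum_nonneg fun _ => by positivity) g2 (by positivity)
    have hsum := (A1.1.add A2.1).mul_left γ
    have hle : ∀ x, |(|u (x + Pi.single i 1)| ^ γ) - |u x| ^ γ| ≤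
        γ * (|u (x + Pi.single i 1)| ^ (γ - 1) * |u (x + Pi.single i 1) - u x| +
          |u x| ^ (γ - 1) * |u (x + Pi.single i 1) - u x|) := by
      intro x
      refine (abs_rpow_sub_le hγ1 (abs_nonneg _) (abs_nonneg _)).trans ?_
      rw [← add_mul, mul_assoc]
      exact mul_le_mul_of_nonneg_left (mul_le_mul_of_nonneg_left
        (abs_abs_sub_abs_le (u (x + Pi.single i 1)) (u x)) (by positivity)) (by linarith)
    calc ∑' x, |(|u (x + Pi.single i 1)| ^ γ) - |u x| ^ γ|
        ≤ ∑' x, γ * (|u (x + Pi.single i 1)| ^ (γ - 1) * |u (x + Pi.single i 1) - u x| +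
          |u x| ^ (γ - 1) * |u (x + Pi.single i 1) - u x|) :=
          Summable.tsum_le_tsum hle (Summable.of_nonneg_of_le (fun _ => abs_nonneg _) hle hsum) hsum
      _ = γ * ((∑' x, |u (x + Pi.single i 1)| ^ (γ - 1) * |u (x + Pi.single i 1) - u x|) +
          ∑' x, |u x| ^ (γ - 1) * |u (x + Pi.single i 1) - u x|) := by
          rw [tsum_mul_left, A1.1.tsum_add A2.1]
      _ ≤ γ * (S ^ (1 / q) * (2 * D) ^ (1 / p) + S ^ (1 / q) * (2 * D) ^ (1 / p)) := by
          gcongr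
          · exact A1.2.trans (by gcongr)
          · exact A2.2.trans (by gcongr)
      _ = _ := by ring
  have h2 : S ≤ (2 * γ * N * 2 ^ (1 / p) * (S ^ (1 / q) * D ^ (1 / p))) ^ ((N : ℝ) / (N - 1)) := by
    refine h1.trans (Real.rpow_le_rpow
      (Finset.sum_nonneg fun i _ => tsum_nonneg fun _ => abs_nonneg _) ?_ (by positivity))
    refine (Finset.sum_le_sum fun i _ => hterm i).trans (le_of_eq ?_)
    rw [Finset.sum_const, Finset.card_univ, Fintype.card_fin, nsmul_eq_mul,
      Real.mul_rpow (by norm_num) hD0]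
    ring
  -- The case `S = 0` is separated because `S ^ (1 / q)` is about to be cancelled. What remains on
  -- the left has exponent `1 - 1 / N - 1 / q = 1 / p^*`.
  rcases hS0.eq_or_lt with h0 | hSpos
  · rw [← h0]; positivity
  have h3 : S ^ (1 - 1 / (N : ℝ)) ≤ 2 * γ * N * 2 ^ (1 / p) * (S ^ (1 / q) * D ^ (1 / p)) := by
    have := Real.rpow_le_rpow hS0 h2 (by
      rw [sub_nonneg, div_le_one (by linarith)]; exact hN1.le : (0 : ℝ) ≤ 1 - 1 / (N : ℝ))
    rwa [← Real.rpow_mul (by positivity), show (N : ℝ) / (N - 1) * (1 - 1 / N) = 1 by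
      field_simp, Real.rpow_one] at this
  have h4 : S ^ (1 / pStar N p) ≤ 2 * γ * N * 2 ^ (1 / p) * D ^ (1 / p) := by
    have e : 1 - 1 / (N : ℝ) = 1 / pStar N p + 1 / q := by
      have : p - 1 ≠ 0 := by linarith
      rw [← hps', hq]; field_simp; ring
    rw [e, Real.rpow_add hSpos] at h3
    have hq' : 0 < S ^ (1 / q) := by positivity
    refine le_of_mul_le_mul_right (h3.trans (le_of_eq ?_)) hq'
    ring
  have h5 := Real.rpow_le_rpow (by positivity) h4 hps0.le
  rw [← Real.rpow_mul hS0, one_div_mul_cancel hps0.ne', Real.rpow_one,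
    Real.mul_rpow (by positivity) (by positivity), ← Real.rpow_mul hD0] at h5
  rwa [show pStar N p / p = 1 / p * pStar N p by ring]

/-! ### The space `E` as the functions of finite energy that vanish at infinity. -/

/-- This crude convexity bound replaces the triangle inequality: a quasi-norm estimate for `normPow`
is all that is needed later. -/
lemma abs_add_rpow_le {p : ℝ} (hp : 0 ≤ p) (a b : ℝ) :
    |a + b| ^ p ≤ 2 ^ p * (|a| ^ p + |b| ^ p) := by
  have h : |a + b| ≤ 2 * max |a| |b| := by
    have := abs_add_le a b
    have := le_max_left |a| |b|
    have := le_max_right |a| |b|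
    linarith
  calc |a + b| ^ p ≤ (2 * max |a| |b|) ^ p := Real.rpow_le_rpow (abs_nonneg _) h hp
    _ = 2 ^ p * max |a| |b| ^ p := Real.mul_rpow (by norm_num) (by positivity)
    _ ≤ _ := by
      gcongr
      have ha : 0 ≤ |a| ^ p := by positivity
      have hb : 0 ≤ |b| ^ p := by positivity
      rcases max_cases |a| |b| with h | h <;> rw [h.1] <;> linarith

/-- Fatou's lemma for series with nonnegative terms. -/
lemma tsum_le_of_tendsto {X : Type*} {g : ℕ → X → ℝ} {h : X → ℝ} {C : ℝ}
    (hg : ∀ n x, 0 ≤ g n x) (hs : ∀ n, Summable (g n)) (hC : ∀ᶠ n in atTop, ∑' x, g n x ≤ C)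
    (ht : ∀ x, Tendsto (fun n => g n x) atTop (𝓝 (h x))) :
    Summable h ∧ ∑' x, h x ≤ C := by
  have h0 : 0 ≤ h := fun x => ge_of_tendsto' (ht x) fun n => hg n x
  have hfin : ∀ s : Finset X, ∑ x ∈ s, h x ≤ C := fun s =>
    le_of_tendsto (tendsto_finsetSum s fun x _ => ht x) <| hC.mono fun n hn =>
      ((hs n).sum_le_tsum s fun x _ => hg n x).trans hn
  have hsum := summable_of_sum_le h0 hfin
  exact ⟨hsum, hsum.tsum_le_of_sum_le hfin⟩

/-- An intrinsic description of the elements of `E`: functions vanishing at infinity with finite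
energy. -/
structure InE {N : ℕ} (p : ℝ) (V u : (Fin N → ℤ) → ℝ) : Prop where
  zero : Tendsto u cofinite (𝓝 0)
  grad : Summable fun d : (lattice N).Dart => |u d.snd - u d.fst| ^ p
  pot : Summable fun x => V x * |u x| ^ p

/-- The potential energy `∑_x V x |u x| ^ p`. -/
noncomputable def potPow {N : ℕ} (p : ℝ) (V u : (Fin N → ℤ) → ℝ) : ℝ :=
  ∑' x, V x * |u x| ^ p

lemma normPow_eq {N : ℕ} (p : ℝ) (V u : (Fin N → ℤ) → ℝ) :
    normPow p V u = gradPow p u + potPow p V u := rfl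

section Space

variable {N : ℕ} {p : ℝ} {V : (Fin N → ℤ) → ℝ}

lemma gradPow_nonneg (u : (Fin N → ℤ) → ℝ) : 0 ≤ gradPow p u :=
  tsum_nonneg fun _ => by positivity

lemma potPow_nonneg (hV : ∀ x, 0 ≤ V x) (u : (Fin N → ℤ) → ℝ) : 0 ≤ potPow p V u :=
  tsum_nonneg fun x => mul_nonneg (hV x) (by positivity)

lemma normPow_nonneg (hV : ∀ x, 0 ≤ V x) (u : (Fin N → ℤ) → ℝ) : 0 ≤ normPow p V u :=
  add_nonneg (gradPow_nonneg u) (potPow_nonneg hV u)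

lemma normPow_smul (c : ℝ) (u : (Fin N → ℤ) → ℝ) :
    normPow p V (c • u) = |c| ^ p * normPow p V u := by
  simp only [normPow, Pi.smul_apply, smul_eq_mul, ← mul_sub, abs_mul,
    Real.mul_rpow (abs_nonneg _) (abs_nonneg _)]
  rw [mul_add, ← tsum_mul_left, ← tsum_mul_left]
  congr 1 <;> congr 1 <;> ext x <;> ring

lemma InE.smul {u : (Fin N → ℤ) → ℝ} (hu : InE p V u) (c : ℝ) : InE p V (c • u) := by
  refine ⟨mul_zero c ▸ hu.zero.const_mul c, ?_, ?_⟩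
  · refine (hu.grad.mul_left (|c| ^ p)).congr fun d => ?_
    simp only [Pi.smul_apply, smul_eq_mul, ← mul_sub, abs_mul,
      Real.mul_rpow (abs_nonneg _) (abs_nonneg _)]
  · refine (hu.pot.mul_left (|c| ^ p)).congr fun d => ?_
    simp only [Pi.smul_apply, smul_eq_mul, abs_mul,
      Real.mul_rpow (abs_nonneg _) (abs_nonneg _)]
    ring

/-- If `|∇w| ≤ |∇u|` and `|w| ≤ |u|` pointwise, then `w` has no more energy than `u`. -/
lemma InE.of_le (hp : 0 ≤ p) (hV : ∀ x, 0 ≤ V x) {u w : (Fin N → ℤ) → ℝ} (hu : InE p V u)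
    (h1 : ∀ x y, |w y - w x| ≤ |u y - u x|) (h2 : ∀ x, |w x| ≤ |u x|) :
    InE p V w ∧ gradPow p w ≤ gradPow p u ∧ potPow p V w ≤ potPow p V u := by
  have k1 : ∀ d : (lattice N).Dart, |w d.snd - w d.fst| ^ p ≤ |u d.snd - u d.fst| ^ p :=
    fun d => Real.rpow_le_rpow (abs_nonneg _) (h1 _ _) hp
  have k2 : ∀ x, V x * |w x| ^ p ≤ V x * |u x| ^ p := fun x =>
    mul_le_mul_of_nonneg_left (Real.rpow_le_rpow (abs_nonneg _) (h2 x) hp) (hV x)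
  have s1 := Summable.of_nonneg_of_le (fun _ => by positivity) k1 hu.grad
  have s2 := Summable.of_nonneg_of_le (fun x => mul_nonneg (hV x) (by positivity)) k2 hu.pot
  refine ⟨⟨?_, s1, s2⟩, ?_, s2.tsum_le_tsum k2 hu.pot⟩
  · exact squeeze_zero_norm h2 (by simpa using hu.zero.abs)
  · exact (s1.mul_left _).tsum_le_tsum (fun d => mul_le_mul_of_nonneg_left (k1 d) (by norm_num)) (hu.grad.mul_left _)

lemma InE.add (hp : 0 ≤ p) (hV : ∀ x, 0 ≤ V x) {u w : (Fin N → ℤ) → ℝ} (hu : InE p V u)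
    (hw : InE p V w) : InE p V (u + w) ∧
      normPow p V (u + w) ≤ 2 ^ p * (normPow p V u + normPow p V w) := by
  have k1 : ∀ d : (lattice N).Dart, |(u + w) d.snd - (u + w) d.fst| ^ p ≤
      2 ^ p * (|u d.snd - u d.fst| ^ p + |w d.snd - w d.fst| ^ p) := fun d => by
    rw [show (u + w) d.snd - (u + w) d.fst = (u d.snd - u d.fst) + (w d.snd - w d.fst) by
      simp; ring]
    exact abs_add_rpow_le hp _ _
  have k2 : ∀ x, V x * |(u + w) x| ^ p ≤ 2 ^ p * (V x * |u x| ^ p + V x * |w x| ^ p) :=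
    fun x => by
      rw [← mul_add, mul_left_comm]
      exact mul_le_mul_of_nonneg_left (abs_add_rpow_le hp _ _) (hV x)
  have t1 := (hu.grad.add hw.grad).mul_left (2 ^ p)
  have t2 := (hu.pot.add hw.pot).mul_left (2 ^ p)
  have s1 := Summable.of_nonneg_of_le (fun _ => by positivity) k1 t1
  have s2 := Summable.of_nonneg_of_le (fun x => mul_nonneg (hV x) (by positivity)) k2 t2
  refine ⟨⟨add_zero (0 : ℝ) ▸ hu.zero.add hw.zero, s1, s2⟩, ?_⟩
  have r1 := s1.tsum_le_tsum k1 t1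
  have r2 := s2.tsum_le_tsum k2 t2
  rw [tsum_mul_left, hu.grad.tsum_add hw.grad] at r1
  rw [tsum_mul_left, hu.pot.tsum_add hw.pot] at r2
  simp only [normPow, tsum_mul_left]
  nlinarith

lemma InE.sub (hp : 0 ≤ p) (hV : ∀ x, 0 ≤ V x) {u w : (Fin N → ℤ) → ℝ} (hu : InE p V u)
    (hw : InE p V w) : InE p V (u - w) ∧
      normPow p V (u - w) ≤ 2 ^ p * (normPow p V u + normPow p V w) := by
  have h := hu.add hp hV (hw.smul (-1))
  have e : u + (-1 : ℝ) • w = u - w := by ext; simp; ring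
  rw [normPow_smul, e] at h
  simpa using h

lemma InE.of_finite (hp : 0 < p) {u : (Fin N → ℤ) → ℝ} (hu : (Function.support u).Finite) :
    InE p V u := by
  refine ⟨?_, summable_grad_of_finite hp hu, ?_⟩
  · refine tendsto_nhds_of_eventually_eq ?_
    have : {x | u x ≠ 0}.Finite := hu
    filter_upwards [this.compl_mem_cofinite] with x hx
    simpa using hx
  · refine summable_of_hasFiniteSupport <| hu.subset <| by
      intro x hx
      by_contra h
      simp only [Function.mem_support, not_not] at h
      simp [h, Real.zero_rpow hp.ne'] at hx

/-- Truncation of a real number to `[-ε, ε]`. -/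
def clamp (ε a : ℝ) : ℝ := max (-ε) (min a ε)

lemma abs_clamp_sub_le (ε a b : ℝ) : |clamp ε a - clamp ε b| ≤ |a - b| := by
  unfold clamp
  refine (abs_max_sub_max_le_max _ _ _ _).trans ?_
  rw [sub_self, abs_zero, max_eq_right (abs_nonneg _)]
  refine (abs_min_sub_min_le_max _ _ _ _).trans ?_
  rw [sub_self, abs_zero, max_eq_left (abs_nonneg _)]

lemma clamp_zero {ε : ℝ} (hε : 0 ≤ ε) : clamp ε 0 = 0 := by
  simp [clamp, hε]

lemma abs_clamp_le_abs {ε : ℝ} (hε : 0 ≤ ε) (a : ℝ) : |clamp ε a| ≤ |a| := by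
  simpa [clamp_zero hε] using abs_clamp_sub_le ε a 0

lemma abs_clamp_le {ε : ℝ} (hε : 0 ≤ ε) (a : ℝ) : |clamp ε a| ≤ ε :=
  abs_le.2 ⟨le_max_left _ _, max_le (by linarith) (min_le_right _ _)⟩

lemma clamp_of_abs_le {ε a : ℝ} (h : |a| ≤ ε) : clamp ε a = a := by
  have := abs_le.1 h
  simp [clamp, this.1, this.2]

lemma tendsto_clamp (a : ℝ) :
    Tendsto (fun n : ℕ => clamp (1 / ((n : ℝ) + 1)) a) atTop (𝓝 0) :=
  squeeze_zero_norm (fun n => abs_clamp_le (by positivity) a)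
    tendsto_one_div_add_atTop_nhds_zero_nat

/-- Soft thresholding of `u` at level `1 / (n + 1)`. -/
noncomputable def softThreshold (u : (Fin N → ℤ) → ℝ) (n : ℕ) : (Fin N → ℤ) → ℝ :=
  u - fun x => clamp (1 / ((n : ℝ) + 1)) (u x)

lemma softThreshold_finite {u : (Fin N → ℤ) → ℝ} (hu : Tendsto u cofinite (𝓝 0)) (n : ℕ) :
    (Function.support (softThreshold u n)).Finite := by
  have h : ∀ᶠ x in cofinite, |u x| < 1 / ((n : ℝ) + 1) :=
    (by simpa using hu.abs : Tendsto (fun x => |u x|) cofinite (𝓝 0)).eventually_lt_const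
      (by positivity)
  refine (eventually_cofinite.1 h).subset fun x hx hlt => hx ?_
  rw [softThreshold, Pi.sub_apply, clamp_of_abs_le hlt.le, sub_self]

lemma tendsto_softThreshold (u : (Fin N → ℤ) → ℝ) (x : Fin N → ℤ) :
    Tendsto (fun n => softThreshold u n x) atTop (𝓝 (u x)) := by
  simpa [softThreshold] using (tendsto_clamp (u x)).const_sub (u x)

/-- Truncation is 1-Lipschitz and fixes `0`, so the energy density of the truncated function is
dominated by that of `u`, and dominated convergence applies. -/
lemma tendsto_normPow_clamp (hp : 0 < p) (hV : ∀ x, 0 ≤ V x) {u : (Fin N → ℤ) → ℝ}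
    (hu : InE p V u) :
    Tendsto (fun n : ℕ => normPow p V fun x => clamp (1 / ((n : ℝ) + 1)) (u x)) atTop (𝓝 0) := by
  have hr : Tendsto (fun t : ℝ => |t| ^ p) (𝓝 0) (𝓝 0) := by
    have : Continuous fun t : ℝ => |t| ^ p := continuous_abs.rpow_const fun _ => Or.inr hp.le
    simpa [Real.zero_rpow hp.ne'] using this.tendsto 0
  have h1 : Tendsto (fun n : ℕ => gradPow p fun x => clamp (1 / ((n : ℝ) + 1)) (u x)) atTop
      (𝓝 (∑' _ : (lattice N).Dart, (0 : ℝ))) := by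
    refine tendsto_tsum_of_dominated_convergence (hu.grad.mul_left (1 / 2)) (fun d => ?_)
      (Eventually.of_forall fun n d => ?_)
    · have := (tendsto_clamp (u d.snd)).sub (tendsto_clamp (u d.fst))
      rw [sub_zero] at this
      have := (hr.comp this).const_mul (1 / 2)
      rwa [mul_zero] at this
    · rw [Real.norm_of_nonneg (by positivity)]
      exact mul_le_mul_of_nonneg_left (Real.rpow_le_rpow (abs_nonneg _)
        (abs_clamp_sub_le _ _ _) hp.le) (by norm_num)
  have h2 : Tendsto (fun n : ℕ => potPow p V fun x => clamp (1 / ((n : ℝ) + 1)) (u x)) atTop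
      (𝓝 (∑' _ : Fin N → ℤ, (0 : ℝ))) := by
    refine tendsto_tsum_of_dominated_convergence hu.pot (fun x => ?_)
      (Eventually.of_forall fun n x => ?_)
    · simpa using (hr.comp (tendsto_clamp (u x))).const_mul (V x)
    · rw [Real.norm_of_nonneg (mul_nonneg (hV x) (by positivity))]
      exact mul_le_mul_of_nonneg_left (Real.rpow_le_rpow (abs_nonneg _)
        (abs_clamp_le_abs (by positivity) _) hp.le) (hV x)
  have := h1.add h2
  rwa [tsum_zero, tsum_zero, add_zero] at this

lemma inE_clamp (hp : 0 < p) (hV : ∀ x, 0 ≤ V x) {u : (Fin N → ℤ) → ℝ}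
    (hu : InE p V u) (n : ℕ) : InE p V (fun x => clamp (1 / ((n : ℝ) + 1)) (u x)) ∧
      normPow p V (fun x => clamp (1 / ((n : ℝ) + 1)) (u x)) ≤ normPow p V u := by
  obtain ⟨h, h1, h2⟩ := hu.of_le hp.le hV (w := fun x => clamp (1 / ((n : ℝ) + 1)) (u x))
    (fun _ _ => abs_clamp_sub_le _ _ _) fun _ => abs_clamp_le_abs (by positivity) _
  exact ⟨h, add_le_add h1 h2⟩

/-- The discrete Sobolev inequality on the space of functions of finite energy. -/
theorem sobolev (hp : 1 < p) (hpN : p < N) (hV : ∀ x, 0 ≤ V x) :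
    ∃ K > 0, ∀ u : (Fin N → ℤ) → ℝ, InE p V u → (Summable fun x => |u x| ^ pStar N p) ∧
      ∑' x, |u x| ^ pStar N p ≤ K * normPow p V u ^ (pStar N p / p) := by
  obtain ⟨K, hK, h⟩ := sobolev_finite hp hpN
  obtain ⟨hps, -⟩ := pStar_pos_aux hp hpN
  have hp0 : 0 < p := by linarith
  have hps0 : 0 < pStar N p := hp0.trans hps
  -- Each soft threshold is `u` minus a truncation whose energy is at most that of `u`, so its own
  -- energy is at most `2 ^ p * 2` times that of `u`. Fatou's lemma then passes to the limit.
  refine ⟨K * (2 ^ p * 2) ^ (pStar N p / p), by positivity, fun u hu => ?_⟩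
  have hfin := softThreshold_finite hu.zero
  refine tsum_le_of_tendsto (g := fun n x => |softThreshold u n x| ^ pStar N p)
    (fun _ _ => by positivity) (fun n => ?_) (Eventually.of_forall fun n => ?_) fun x => ?_
  · refine summable_of_hasFiniteSupport <| (hfin n).subset <| by
      intro x hx
      by_contra h
      simp only [Function.mem_support, not_not] at h
      simp [h, Real.zero_rpow hps0.ne'] at hx
  · refine (h _ (hfin n)).trans ?_
    obtain ⟨c1, c2⟩ := inE_clamp hp0 hV hu n
    have h3 : gradPow p (softThreshold u n) ≤ 2 ^ p * 2 * normPow p V u := by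
      have h4 := (hu.sub hp0.le hV c1).2
      have h5 : gradPow p (softThreshold u n) ≤ normPow p V (softThreshold u n) :=
        le_add_of_nonneg_right (potPow_nonneg hV _)
      refine h5.trans (h4.trans ?_)
      have : (0 : ℝ) < 2 ^ p := by positivity
      nlinarith
    rw [mul_assoc, ← Real.mul_rpow (by positivity) (normPow_nonneg hV u)]
    gcongr
    exact gradPow_nonneg _
  · exact (tendsto_softThreshold u x).abs.rpow_const (Or.inr hps0.le)

lemma tendsto_cofinite_of_summable_rpow {X : Type*} {r : ℝ} (hr : 0 < r) {u : X → ℝ}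
    (hu : Summable fun x => |u x| ^ r) : Tendsto u cofinite (𝓝 0) := by
  have h := hu.tendsto_cofinite_zero.rpow_const (p := 1 / r) (Or.inr (by positivity))
  rw [Real.zero_rpow (by positivity)] at h
  refine squeeze_zero_norm (fun x => le_of_eq ?_) h
  rw [← Real.rpow_mul (abs_nonneg _), mul_one_div_cancel hr.ne', Real.rpow_one, Real.norm_eq_abs]

/-- Pointwise limits of sequences with bounded energy have finite energy. -/
lemma InE.of_tendsto (hp : 1 < p) (hpN : p < N) (hV : ∀ x, 0 ≤ V x) {w : ℕ → (Fin N → ℤ) → ℝ}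
    {u : (Fin N → ℤ) → ℝ} {M : ℝ} (hw : ∀ n, InE p V (w n))
    (hM : ∀ᶠ n in atTop, normPow p V (w n) ≤ M)
    (ht : ∀ x, Tendsto (fun n => w n x) atTop (𝓝 (u x))) : InE p V u := by
  obtain ⟨K, hK, h⟩ := sobolev hp hpN hV
  have hp0 : 0 < p := by linarith
  have hps0 : 0 < pStar N p := hp0.trans (pStar_pos_aux hp hpN).1
  refine ⟨?_, ?_, ?_⟩
  -- Decay at infinity is not stable under pointwise limits. It is recovered from the uniform
  -- `ℓ^{p^*}` bound, which Fatou's lemma transfers to the limit.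
  · refine tendsto_cofinite_of_summable_rpow hps0 (tsum_le_of_tendsto
      (g := fun n x => |w n x| ^ pStar N p) (C := K * M ^ (pStar N p / p))
      (fun _ _ => by positivity) (fun n => (h _ (hw n)).1) (hM.mono fun n hn => ?_)
      fun x => (ht x).abs.rpow_const (Or.inr hps0.le)).1
    refine (h _ (hw n)).2.trans ?_
    gcongr
    exact normPow_nonneg hV _
  · refine (tsum_le_of_tendsto (g := fun n (d : (lattice N).Dart) => |w n d.snd - w n d.fst| ^ p)
      (C := 2 * M) (fun _ _ => by positivity) (fun n => (hw n).grad) (hM.mono fun n hn => ?_)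
      fun d => ((ht _).sub (ht _)).abs.rpow_const (Or.inr hp0.le)).1
    have h1 := potPow_nonneg (p := p) hV (w n)
    rw [normPow_eq, gradPow, tsum_mul_left] at hn
    linarith
  · refine (tsum_le_of_tendsto (g := fun n x => V x * |w n x| ^ p)
      (C := M) (fun _ x => mul_nonneg (hV x) (by positivity)) (fun n => (hw n).pot)
      (hM.mono fun n hn => ?_)
      fun x => ((ht _).abs.rpow_const (Or.inr hp0.le)).const_mul _).1
    have h1 := gradPow_nonneg (p := p) (w n)
    rw [normPow_eq] at hn
    change potPow p V (w n) ≤ M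
    linarith

/-- A Cauchy sequence has bounded energy, so its pointwise limit has finite energy and decays.
Conversely, soft thresholds of a decaying function have finite support, and two of them differ by
two truncations whose energies tend to `0`. -/
theorem mem_E_iff (hp : 1 < p) (hpN : p < N) (hV : ∀ x, 0 ≤ V x) {u : (Fin N → ℤ) → ℝ} :
    u ∈ E p V ↔ InE p V u := by
  have hp0 : 0 < p := by linarith
  constructor
  · rintro ⟨w, hfin, hcau, ht⟩
    obtain ⟨n₀, hn₀⟩ := hcau 1 one_pos
    have hw : ∀ n, InE p V (w n) := fun n => InE.of_finite hp0 (hfin n)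
    refine InE.of_tendsto hp hpN hV hw (M := 2 ^ p * (1 + normPow p V (w n₀))) ?_ ht
    filter_upwards [eventually_ge_atTop n₀] with n hn
    have h1 : normPow p V (w n - w n₀) ≤ 1 := by
      by_contra! h
      have := hn₀ n hn n₀ le_rfl
      rw [eNorm] at this
      exact absurd this (not_lt.2 (Real.one_le_rpow h.le (by positivity)))
    have h2 := (((hw n).sub hp0.le hV (hw n₀)).1.add hp0.le hV (hw n₀)).2
    rw [sub_add_cancel] at h2
    refine h2.trans ?_
    gcongr
  · intro hu
    refine ⟨softThreshold u, softThreshold_finite hu.zero, fun ε hε => ?_,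
      tendsto_softThreshold u⟩
    have hlim := tendsto_normPow_clamp hp0 hV hu
    have hη : 0 < ε ^ p / (2 ^ p * 2) := by positivity
    obtain ⟨n₀, hn₀⟩ := eventually_atTop.1 (hlim.eventually_lt_const hη)
    refine ⟨n₀, fun m hm n hn => ?_⟩
    have e : softThreshold u m - softThreshold u n =
        (fun x => clamp (1 / ((n : ℝ) + 1)) (u x)) - fun x => clamp (1 / ((m : ℝ) + 1)) (u x) := by
      ext x; simp [softThreshold]
    have h1 := ((inE_clamp hp0 hV hu n).1.sub hp0.le hV (inE_clamp hp0 hV hu m).1).2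
    rw [← e] at h1
    have h2 : normPow p V (softThreshold u m - softThreshold u n) < ε ^ p := by
      refine h1.trans_lt ?_
      calc _ < 2 ^ p * (ε ^ p / (2 ^ p * 2) + ε ^ p / (2 ^ p * 2)) := by
            have := hn₀ n hn
            have := hn₀ m hm
            gcongr
        _ = ε ^ p := by field_simp; ring
    have h3 := Real.rpow_lt_rpow (normPow_nonneg hV _) h2 (by positivity : 0 < 1 / p)
    rwa [← Real.rpow_mul hε.le, mul_one_div_cancel hp0.ne', Real.rpow_one] at h3

/-- Definiteness comes from Sobolev's inequality, so it holds even where `V` vanishes. -/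
lemma normPow_pos (hp : 1 < p) (hpN : p < N) (hV : ∀ x, 0 ≤ V x) {u : (Fin N → ℤ) → ℝ}
    (hu : InE p V u) (h0 : u ≠ 0) : 0 < normPow p V u := by
  refine (normPow_nonneg hV u).lt_of_ne fun h => h0 ?_
  obtain ⟨K, hK, hS⟩ := sobolev hp hpN hV
  have hps0 : 0 < pStar N p := by linarith [(pStar_pos_aux hp hpN).1]
  obtain ⟨h1, h2⟩ := hS u hu
  rw [← h, Real.zero_rpow (by positivity), mul_zero] at h2
  ext x
  have h3 := (h1.le_tsum x fun _ _ => by positivity).trans h2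
  have h4 : |u x| ^ pStar N p = 0 := le_antisymm h3 (by positivity)
  simpa using (Real.rpow_eq_zero (abs_nonneg _) hps0.ne').1 h4

/-- Translation of darts. -/
def dartShift (z : Fin N → ℤ) : (lattice N).Dart ≃ (lattice N).Dart where
  toFun d := ⟨(d.fst + z, d.snd + z), by
    have : ∑ i, |d.fst i - d.snd i| = 1 := d.adj
    change ∑ i, |(d.fst + z) i - (d.snd + z) i| = 1
    simpa using this⟩
  invFun d := ⟨(d.fst - z, d.snd - z), by
    have : ∑ i, |d.fst i - d.snd i| = 1 := d.adj
    change ∑ i, |(d.fst - z) i - (d.snd - z) i| = 1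
    simpa using this⟩
  left_inv d := by ext <;> simp
  right_inv d := by ext <;> simp

lemma InE.shift {u : (Fin N → ℤ) → ℝ} (hu : InE p V u) {z : Fin N → ℤ}
    (hz : ∀ x, V (x + z) = V x) : InE p V (fun x => u (x + z)) := by
  refine ⟨hu.zero.comp (add_left_injective z).tendsto_cofinite,
    (dartShift z).summable_iff.2 hu.grad, ?_⟩
  refine ((Equiv.addRight z).summable_iff.2 hu.pot).congr fun x => ?_
  simp [hz]

lemma normPow_shift (u : (Fin N → ℤ) → ℝ) {z : Fin N → ℤ} (hz : ∀ x, V (x + z) = V x) :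
    normPow p V (fun x => u (x + z)) = normPow p V u := by
  refine congrArg₂ (· + ·) ((dartShift z).tsum_eq
    fun d : (lattice N).Dart => (1 / 2) * |u d.snd - u d.fst| ^ p) ?_
  rw [← (Equiv.addRight z).tsum_eq fun x => V x * |u x| ^ p]
  simp [hz]

end Space

/-! ### Brezis–Lieb splitting. -/

/-- The summation step of the Brezis–Lieb lemma: almost dominated series of terms tending to
zero tend to zero. -/
theorem tendsto_tsum_of_almost_dominated {X : Type*} {D φ : ℕ → X → ℝ} {ψ : X → ℝ} {K : ℝ}
    (hφ0 : ∀ n x, 0 ≤ φ n x) (hφ : ∀ n, Summable (φ n)) (hK : ∀ n, ∑' x, φ n x ≤ K)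
    (hψ : Summable ψ)
    (hD : ∀ ε > 0, ∃ C, ∀ n x, |D n x| ≤ ε * φ n x + C * ψ x)
    (ht : ∀ x, Tendsto (fun n => D n x) atTop (𝓝 0)) :
    Tendsto (fun n => ∑' x, D n x) atTop (𝓝 0) := by
  have hK0 : 0 ≤ K := (tsum_nonneg (hφ0 0)).trans (hK 0)
  rw [Metric.tendsto_atTop]
  intro ε hε
  set η := ε / (2 * (K + 1)) with hη
  have hη0 : 0 < η := by positivity
  obtain ⟨C, hC⟩ := hD η hη0
  -- The excess of `|D|` over `η φ` is dominated by `|C ψ|` and tends to `0` by dominated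
  -- convergence. The rest sums to at most `η K < ε / 2`.
  have hlim : Tendsto (fun n => ∑' x, max 0 (|D n x| - η * φ n x)) atTop
      (𝓝 (∑' _ : X, (0 : ℝ))) := by
    refine tendsto_tsum_of_dominated_convergence (hψ.mul_left C).abs (fun x => ?_)
      (Eventually.of_forall fun n x => ?_)
    · refine squeeze_zero (fun n => le_max_left _ _) (fun n => ?_)
        (by simpa using (ht x).abs : Tendsto (fun n => |D n x|) atTop (𝓝 0))
      exact max_le (abs_nonneg _) (by linarith [mul_nonneg hη0.le (hφ0 n x)])
    · rw [Real.norm_of_nonneg (le_max_left _ _)]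
      exact max_le (abs_nonneg _) (by linarith [hC n x, le_abs_self (C * ψ x)])
  rw [tsum_zero] at hlim
  obtain ⟨n₀, hn₀⟩ := eventually_atTop.1 (hlim.eventually_lt_const (half_pos hε))
  refine ⟨n₀, fun n hn => ?_⟩
  have hs1 : Summable fun x => max 0 (|D n x| - η * φ n x) :=
    Summable.of_nonneg_of_le (fun _ => le_max_left _ _)
      (fun x => max_le (abs_nonneg _) (by linarith [hC n x, le_abs_self (C * ψ x)]))
      (hψ.mul_left C).abs
  have hs2 := (hφ n).mul_left η
  have hle : ∀ x, |D n x| ≤ max 0 (|D n x| - η * φ n x) + η * φ n x := fun x => by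
    linarith [le_max_right 0 (|D n x| - η * φ n x)]
  have hs3 : Summable fun x => |D n x| :=
    Summable.of_nonneg_of_le (fun _ => abs_nonneg _) hle (hs1.add hs2)
  rw [dist_zero_right]
  calc ‖∑' x, D n x‖ ≤ ∑' x, |D n x| := norm_tsum_le_tsum_norm hs3
    _ ≤ ∑' x, (max 0 (|D n x| - η * φ n x) + η * φ n x) := hs3.tsum_le_tsum hle (hs1.add hs2)
    _ = (∑' x, max 0 (|D n x| - η * φ n x)) + η * ∑' x, φ n x := by
        rw [hs1.tsum_add hs2, tsum_mul_left]
    _ < ε / 2 + η * (K + 1) := by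
        have h1 := hn₀ n hn
        have h2 : η * ∑' x, φ n x ≤ η * (K + 1) :=
          mul_le_mul_of_nonneg_left (by linarith [hK n]) hη0.le
        linarith
    _ = ε := by rw [hη]; field_simp; ring

/-- The Brezis–Lieb splitting estimate for `|t| ^ p`. -/
lemma abs_rpow_split {p : ℝ} (hp : 0 < p) {ε : ℝ} (hε : 0 < ε) :
    ∃ C, ∀ a b : ℝ, |(|a + b| ^ p) - |a| ^ p - |b| ^ p| ≤ ε * |a| ^ p + C * |b| ^ p := by
  have hc : Tendsto (fun s : ℝ => |1 + s| ^ p) (𝓝 0) (𝓝 1) := by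
    have : Continuous fun s : ℝ => |1 + s| ^ p :=
      (continuous_const.add continuous_id).abs.rpow_const fun _ => Or.inr hp.le
    simpa using this.tendsto 0
  obtain ⟨δ, hδ, hδ'⟩ := Metric.tendsto_nhds_nhds.1 hc ε hε
  refine ⟨(1 / δ + 1) ^ p + (1 / δ) ^ p + 1, fun a b => ?_⟩
  have hbp : 0 ≤ |b| ^ p := by positivity
  -- If `|b|` is small relative to `|a|`, homogeneity reduces the claim to continuity of `|1 + s| ^
  -- p` at `0`. Otherwise every term is a multiple of `|b| ^ p`.
  rcases lt_or_ge |b| (δ * |a|) with h | h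
  · have ha : 0 < |a| := by
      rcases (abs_nonneg a).eq_or_lt with h0 | h0
      · rw [← h0, mul_zero] at h; exact absurd h (not_lt.2 (abs_nonneg _))
      · exact h0
    have ha' : a ≠ 0 := abs_pos.1 ha
    have h1 := hδ' (x := b / a) (by
      rw [dist_zero_right, Real.norm_eq_abs, abs_div, div_lt_iff₀ ha]; exact h)
    rw [Real.dist_eq] at h1
    have e : |a + b| ^ p = |1 + b / a| ^ p * |a| ^ p := by
      rw [← Real.mul_rpow (abs_nonneg _) (abs_nonneg _), ← abs_mul]
      congr 2; field_simp
    have hap : 0 ≤ |a| ^ p := by positivity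
    have h2 : |(|a + b| ^ p) - |a| ^ p| ≤ ε * |a| ^ p := by
      rw [e, show |1 + b / a| ^ p * |a| ^ p - |a| ^ p = (|1 + b / a| ^ p - 1) * |a| ^ p by ring,
        abs_mul, abs_of_nonneg hap]
      gcongr
    have h3 := abs_sub (|a + b| ^ p - |a| ^ p) (|b| ^ p)
    rw [abs_of_nonneg hbp] at h3
    have h4 : 1 * |b| ^ p ≤ ((1 / δ + 1) ^ p + (1 / δ) ^ p + 1) * |b| ^ p := by
      gcongr
      have : 0 ≤ (1 / δ + 1) ^ p := by positivity
      have : 0 ≤ (1 / δ) ^ p := by positivity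
      linarith
    linarith
  · have h1 : |a| ≤ 1 / δ * |b| := by
      rw [one_div_mul_eq_div, le_div_iff₀ hδ]; linarith
    have h2 : |a + b| ≤ (1 / δ + 1) * |b| := (abs_add_le a b).trans (by linarith)
    have h3 := Real.rpow_le_rpow (abs_nonneg _) h1 hp.le
    have h4 := Real.rpow_le_rpow (abs_nonneg _) h2 hp.le
    rw [Real.mul_rpow (by positivity) (by positivity)] at h3 h4
    have h5 := abs_sub (|a + b| ^ p - |a| ^ p) (|b| ^ p)
    have h6 := abs_sub (|a + b| ^ p) (|a| ^ p)
    have hap : 0 ≤ |a| ^ p := by positivity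
    have habp : 0 ≤ |a + b| ^ p := by positivity
    rw [abs_of_nonneg hbp] at h5
    rw [abs_of_nonneg hap, abs_of_nonneg habp] at h6
    have := mul_nonneg hε.le hap
    linarith

/-- The Brezis–Lieb splitting estimate for a locally equicontinuous family of order `o(|t| ^ r)`
at the origin. -/
lemma split_of_isLittleO {X : Type*} {h : X → ℝ → ℝ} {r : ℝ} (hr : 0 < r)
    (small : ∀ ε > 0, ∃ δ > 0, ∀ x t, |t| < δ → |h x t| ≤ ε * |t| ^ r)
    (loc : ∀ M, ∃ C ≥ 0, ∀ x t, |t| ≤ M → |h x t| ≤ C * |t| ^ r)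
    (equi : ∀ M, ∀ ε > 0, ∃ δ > 0, ∀ x s t, |s| ≤ M → |t| ≤ M → |s - t| < δ →
      |h x s - h x t| ≤ ε) (M : ℝ) {ε : ℝ} (hε : 0 < ε) :
    ∃ C, ∀ x a b, |a| ≤ M → |b| ≤ M →
      |h x (a + b) - h x a - h x b| ≤ ε * |a| ^ r + C * |b| ^ r := by
  obtain ⟨C, hC0, hC⟩ := loc (2 * M)
  obtain ⟨η, hη, hη'⟩ := small (ε / (2 ^ r + 1)) (by positivity)
  -- This tolerance is at most `ε |a| ^ r` as soon as `|a| ≥ η / 2`, which is the regime where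
  -- equicontinuity is used.
  obtain ⟨δ, hδ, hδ'⟩ := equi (2 * M) (ε * (η / 2) ^ r) (by positivity)
  -- The entry `2` serves the case `|b| > |a|`, and `2 M / δ` the case `|b| ≥ δ`. In both, `a` and
  -- `a + b` are bounded by `L |b|`.
  set L := max 2 (2 * M / δ) with hL
  have hL2 : 2 ≤ L := le_max_left _ _
  refine ⟨C * (2 * L ^ r + 1), fun x a b ha hb => ?_⟩
  have hab : |a + b| ≤ 2 * M := (abs_add_le a b).trans (by linarith)
  have ha0 := abs_nonneg a
  have hb0 := abs_nonneg b
  have hhb := hC x b (by linarith)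
  have hLr : 0 ≤ L ^ r := by positivity
  have har : 0 ≤ |a| ^ r := by positivity
  have hbr : 0 ≤ |b| ^ r := by positivity
  have tri := abs_sub (h x (a + b) - h x a) (h x b)
  have tri2 := abs_sub (h x (a + b)) (h x a)
  have hCL : 0 ≤ C * (2 * L ^ r) * |b| ^ r := by positivity
  have large : |a| ≤ L * |b| → |a + b| ≤ L * |b| →
      |h x (a + b) - h x a - h x b| ≤ ε * |a| ^ r + C * (2 * L ^ r + 1) * |b| ^ r := by
    intro h1 h2
    have k1 := hC x a (by linarith)
    have k2 := hC x (a + b) hab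
    have e1 := Real.rpow_le_rpow (abs_nonneg _) h1 hr.le
    have e2 := Real.rpow_le_rpow (abs_nonneg _) h2 hr.le
    rw [Real.mul_rpow (by positivity) (by positivity)] at e1 e2
    have e1' := mul_le_mul_of_nonneg_left e1 hC0
    have e2' := mul_le_mul_of_nonneg_left e2 hC0
    have := mul_nonneg hε.le har
    nlinarith
  have close : |h x (a + b) - h x a| ≤ ε * |a| ^ r →
      |h x (a + b) - h x a - h x b| ≤ ε * |a| ^ r + C * (2 * L ^ r + 1) * |b| ^ r := by
    intro h1
    nlinarith
  rcases lt_or_ge |a| (η / 2) with h1 | h1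
  · rcases le_or_gt |b| |a| with h2 | h2
    · apply close
      have h3 : |a + b| ≤ 2 * |a| := (abs_add_le a b).trans (by linarith)
      have k1 := hη' x a (by linarith)
      have k2 := hη' x (a + b) (by linarith)
      have e2 := Real.rpow_le_rpow (abs_nonneg _) h3 hr.le
      rw [Real.mul_rpow (by positivity) (by positivity)] at e2
      calc _ ≤ ε / (2 ^ r + 1) * |a + b| ^ r + ε / (2 ^ r + 1) * |a| ^ r := by linarith
        _ ≤ ε / (2 ^ r + 1) * (2 ^ r * |a| ^ r) + ε / (2 ^ r + 1) * |a| ^ r := by gcongr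
        _ = ε * |a| ^ r := by field_simp
    · exact large (by nlinarith) ((abs_add_le a b).trans (by nlinarith))
  · rcases lt_or_ge |b| δ with h2 | h2
    · apply close
      refine (hδ' x (a + b) a hab (by linarith) (by simpa using h2)).trans ?_
      gcongr
    · have hm : 2 * M ≤ L * |b| := by
        calc 2 * M = 2 * M / δ * δ := by field_simp
          _ ≤ L * |b| := by
            gcongr
            exact le_max_right _ _
      exact large (by linarith) (hab.trans hm)

/-! ### Fibering inequalities on a half-line. -/

/-- Properties of a primitive `P` of `g` on the half-line when `g t / t ^ (p - 1)` increases
from `0`. -/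
lemma fibering_pos {p : ℝ} (hp : 1 < p) {g : ℝ → ℝ} (hg : Continuous g)
    (hm : StrictMonoOn (fun t : ℝ => g t / |t| ^ (p - 1)) (Set.Ioi 0))
    (h0 : Tendsto (fun t : ℝ => g t / |t| ^ (p - 1)) (𝓝[>] 0) (𝓝 0)) {a : ℝ} (ha : 0 < a) :
    0 < g a ∧ 0 ≤ ∫ s in (0 : ℝ)..a, g s ∧
      (∀ s, 0 < s → s < 1 → g (s * a) * (s * a) < s ^ p * (g a * a)) ∧
      ∀ s, 0 ≤ s → s ≠ 1 → (s ^ p - 1) / p * (g a * a) <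
        (∫ t in (0 : ℝ)..(s * a), g t) - ∫ t in (0 : ℝ)..a, g t := by
  have hp0 : 0 < p := by linarith
  have hrpos : ∀ t > 0, 0 < g t / |t| ^ (p - 1) := by
    intro t ht
    have h1 : 0 ≤ g (t / 2) / |t / 2| ^ (p - 1) := by
      refine le_of_tendsto h0 ?_
      filter_upwards [Ioo_mem_nhdsGT (half_pos ht)] with s hs
      exact (hm hs.1 (half_pos ht) hs.2).le
    exact h1.trans_lt (hm (half_pos ht) ht (half_lt_self ht))
  have hpw : ∀ t : ℝ, 0 < t → 0 < |t| ^ (p - 1) := fun t ht =>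
    Real.rpow_pos_of_pos (abs_pos.2 ht.ne') _
  have hgpos : ∀ t > 0, 0 < g t := fun t ht => by
    have := mul_pos (hrpos t ht) (hpw t ht)
    rwa [div_mul_cancel₀ _ (hpw t ht).ne'] at this
  have hgr : ∀ t > 0, g t = g t / |t| ^ (p - 1) * t ^ (p - 1) := fun t ht => by
    have h := hpw t ht
    rw [abs_of_pos ht] at h ⊢
    field_simp
  have hpm : ∀ t : ℝ, 0 < t → t ^ (p - 1) * t = t ^ p := fun t ht => by
    rw [← Real.rpow_add_one ht.ne']; ring_nf
  set ρ := g a / |a| ^ (p - 1) with hρ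
  have hga : g a * a = ρ * a ^ p := by rw [hgr a ha, mul_assoc, hpm a ha]
  refine ⟨hgpos a ha, ?_, ?_, ?_⟩
  · refine intervalIntegral.integral_nonneg ha.le fun t ht => ?_
    rcases ht.1.eq_or_lt with h | h
    · rw [← h]
      refine ge_of_tendsto (hg.continuousWithinAt (s := Set.Ioi 0) (x := 0)) ?_
      filter_upwards [self_mem_nhdsWithin] with s hs using (hgpos s hs).le
    · exact (hgpos t h).le
  · intro s hs hs1
    have hsa : 0 < s * a := mul_pos hs ha
    rw [hga, hgr _ hsa, mul_assoc, hpm _ hsa, Real.mul_rpow hs.le ha.le]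
    have : g (s * a) / |s * a| ^ (p - 1) < ρ := hm hsa ha (by nlinarith)
    calc _ < ρ * (s ^ p * a ^ p) := by gcongr
      _ = _ := by ring
  -- The primitive is compared with the `p`-homogeneous function having the same derivative at `a`.
  -- The sign of `Q'` is that of the ratio minus `ρ`, so `a` is the strict minimum of `Q` on `[0,
  -- ∞)`, and `Q a < Q (s a)` is the claim.
  · set Q : ℝ → ℝ := fun b => (∫ t in (0 : ℝ)..b, g t) - ρ * (b ^ p / p) with hQ
    have hPd : ∀ b, HasDerivAt (fun b => ∫ t in (0 : ℝ)..b, g t) (g b) b := fun b =>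
      intervalIntegral.integral_hasDerivAt_right (hg.intervalIntegrable _ _)
        hg.stronglyMeasurable.stronglyMeasurableAtFilter hg.continuousAt
    have hQd : ∀ b, HasDerivAt Q (g b - ρ * b ^ (p - 1)) b := fun b => by
      have h1 := ((Real.hasDerivAt_rpow_const (x := b) (Or.inr hp.le)).div_const p).const_mul ρ
      rw [mul_div_cancel_left₀ _ hp0.ne'] at h1
      exact (hPd b).sub h1
    have hQc : Continuous Q := continuous_iff_continuousAt.2 fun b => (hQd b).continuousAt
    have hQd' : ∀ b > 0, g b - ρ * b ^ (p - 1) = (g b / |b| ^ (p - 1) - ρ) * b ^ (p - 1) :=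
      fun b hb => by rw [sub_mul, ← hgr b hb]
    have hanti : StrictAntiOn Q (Set.Icc 0 a) := by
      refine strictAntiOn_of_deriv_neg (convex_Icc _ _) hQc.continuousOn fun b hb => ?_
      rw [interior_Icc] at hb
      rw [(hQd b).deriv, hQd' b hb.1]
      exact mul_neg_of_neg_of_pos (sub_neg.2 (hm hb.1 ha hb.2)) (Real.rpow_pos_of_pos hb.1 _)
    have hmono : StrictMonoOn Q (Set.Ici a) := by
      refine strictMonoOn_of_deriv_pos (convex_Ici _) hQc.continuousOn fun b hb => ?_
      rw [interior_Ici] at hb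
      have hb0 : 0 < b := ha.trans hb
      rw [(hQd b).deriv, hQd' b hb0]
      exact mul_pos (sub_pos.2 (hm ha hb0 hb)) (Real.rpow_pos_of_pos hb0 _)
    intro s hs0 hs1
    have hlt : Q a < Q (s * a) := by
      rcases lt_or_gt_of_ne hs1 with h | h
      · exact hanti ⟨by positivity, by nlinarith⟩ ⟨ha.le, le_rfl⟩ (by nlinarith)
      · exact hmono Set.self_mem_Ici (by simp only [Set.mem_Ici]; nlinarith) (by nlinarith)
    simp only [hQ] at hlt
    rw [Real.mul_rpow hs0 ha.le] at hlt
    have e : (s ^ p - 1) / p * (g a * a) = ρ * (s ^ p * a ^ p / p) - ρ * (a ^ p / p) := by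
      rw [hga]; ring
    rw [e]
    linarith

/-! ### Periodicity and uniformity in `x`. -/

section Periodic

variable {N : ℕ} {β : Type*}

/-- The group of periods of a function on the lattice. -/
def periods (h : (Fin N → ℤ) → β) : AddSubgroup (Fin N → ℤ) where
  carrier := {z | ∀ x, h (x + z) = h x}
  add_mem' {a b} ha hb x := by rw [← add_assoc, hb, ha]
  zero_mem' x := by rw [add_zero]
  neg_mem' {a} ha x := by
    have := ha (x + -a)
    rw [neg_add_cancel_right] at this
    exact this.symm

lemma IsPeriodic.smul_mem {T : ℕ} {h : (Fin N → ℤ) → β} (hh : IsPeriodic T h) (k : Fin N → ℤ) :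
    (T : ℤ) • k ∈ periods h := by
  have e : (T : ℤ) • k = ∑ i, k i • (Pi.single i (T : ℤ) : Fin N → ℤ) := by
    ext j
    simp [Finset.sum_apply, Pi.single_apply, mul_comm]
  rw [e]
  exact sum_mem fun i _ => zsmul_mem (show Pi.single i (T : ℤ) ∈ periods h from fun x => hh x i) _

/-- Every lattice point can be translated by a period into a fixed finite box. -/
lemma exists_shift_mem_box {T : ℕ} (hT : 0 < T) (x : Fin N → ℤ) :
    ∃ k : Fin N → ℤ, x + (T : ℤ) • k ∈ Set.Icc (0 : Fin N → ℤ) (fun _ => (T : ℤ)) := by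
  have hT' : (0 : ℤ) < T := by exact_mod_cast hT
  refine ⟨fun i => -(x i / T), ⟨fun i => ?_, fun i => ?_⟩⟩
  · have := Int.emod_nonneg (x i) hT'.ne'
    have := Int.emod_add_mul_ediv (x i) T
    simp; linarith
  · have := Int.emod_lt_of_pos (x i) hT'
    have := Int.emod_add_mul_ediv (x i) T
    simp; linarith

lemma IsPeriodic.exists_box {T : ℕ} (hT : 0 < T) {h : (Fin N → ℤ) → β} (hh : IsPeriodic T h)
    (x : Fin N → ℤ) : ∃ y ∈ Set.Icc (0 : Fin N → ℤ) (fun _ => (T : ℤ)), h x = h y := by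
  obtain ⟨k, hk⟩ := exists_shift_mem_box hT x
  exact ⟨_, hk, (hh.smul_mem k x).symm⟩

/-- Up to translation by periods only the finitely many points of a box matter, so compactness in
`t` at each of them gives a constant uniform in `x`. The same reduction gives uniform
equicontinuity. -/
lemma IsPeriodic.bounded {T : ℕ} (hT : 0 < T) {h : (Fin N → ℤ) → ℝ → ℝ} (hh : IsPeriodic T h)
    (hc : ∀ x, Continuous (h x)) (M : ℝ) : ∃ C ≥ 0, ∀ x t, |t| ≤ M → |h x t| ≤ C := by
  have h1 : ∀ y ∈ Set.Icc (0 : Fin N → ℤ) (fun _ => (T : ℤ)),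
      ∀ᶠ C in atTop, ∀ t, |t| ≤ M → |h y t| ≤ C := by
    intro y _
    obtain ⟨C, hC⟩ := isCompact_Icc.exists_bound_of_continuousOn (s := Set.Icc (-M) M)
      (hc y).continuousOn
    filter_upwards [eventually_ge_atTop C] with D hD t ht
    exact (hC t (abs_le.1 ht)).trans hD
  obtain ⟨C, hC, hC0⟩ := (((eventually_all_finite (Set.finite_Icc _ _)).2 h1).and
    (eventually_ge_atTop 0)).exists
  refine ⟨C, hC0, fun x t ht => ?_⟩
  obtain ⟨y, hy, e⟩ := hh.exists_box hT x
  rw [e]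
  exact hC y hy t ht

lemma IsPeriodic.equicontinuous {T : ℕ} (hT : 0 < T) {h : (Fin N → ℤ) → ℝ → ℝ}
    (hh : IsPeriodic T h) (hc : ∀ x, Continuous (h x)) (M : ℝ) {ε : ℝ} (hε : 0 < ε) :
    ∃ δ > 0, ∀ x s t, |s| ≤ M → |t| ≤ M → |s - t| < δ → |h x s - h x t| ≤ ε := by
  have h1 : ∀ y ∈ Set.Icc (0 : Fin N → ℤ) (fun _ => (T : ℤ)),
      ∀ᶠ δ in 𝓝[>] (0 : ℝ), ∀ s t, |s| ≤ M → |t| ≤ M → |s - t| < δ → |h y s - h y t| ≤ ε := by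
    intro y _
    have huc := (isCompact_Icc (a := -M) (b := M)).uniformContinuousOn_of_continuous
      (hc y).continuousOn
    obtain ⟨δ, hδ, hδ'⟩ := Metric.uniformContinuousOn_iff.1 huc ε hε
    filter_upwards [Ioo_mem_nhdsGT hδ] with η hη s t hs ht hst
    exact (hδ' s (abs_le.1 hs) t (abs_le.1 ht) (hst.trans hη.2)).le
  obtain ⟨δ, hδ, hδ0⟩ := (((eventually_all_finite (Set.finite_Icc _ _)).2 h1).and
    self_mem_nhdsWithin).exists
  refine ⟨δ, hδ0, fun x s t hs ht hst => ?_⟩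
  obtain ⟨y, hy, e⟩ := hh.exists_box hT x
  rw [e]
  exact hδ y hy s t hs ht hst

end Periodic

/-! ### Pointwise consequences of the assumptions on `f`. -/

/-- The standing assumptions on the potential and the nonlinearity. -/
structure Assumptions (N : ℕ) (p : ℝ) (T : ℕ) (V : (Fin N → ℤ) → ℝ)
    (f : (Fin N → ℤ) → ℝ → ℝ) : Prop where
  hp : 1 < p
  hpN : p < N
  hT : 0 < T
  hVper : IsPeriodic T V
  hfper : IsPeriodic T f
  hV : ∀ x, 0 ≤ V x
  hfcont : ∀ x, Continuous (f x)
  hzero : ∀ ε > 0, ∃ δ > 0, ∀ x t, 0 < |t| → |t| < δ → |f x t| ≤ ε * |t| ^ (pStar N p - 1)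
  hmono : ∀ x, StrictMonoOn (fun t : ℝ => f x t / |t| ^ (p - 1)) (Set.Iio 0 ∪ Set.Ioi 0)
  hsuper : ∀ M : ℝ, ∃ R > 0, ∀ x t, R < |t| → M ≤ primitive f x t / |t| ^ p

/-- The function `G (x, t) = f (x, t) t / p - F (x, t)`. -/
noncomputable def gap {N : ℕ} (p : ℝ) (f : (Fin N → ℤ) → ℝ → ℝ) (x : Fin N → ℤ) (t : ℝ) : ℝ :=
  f x t * t / p - primitive f x t

lemma primitive_zero {N : ℕ} (f : (Fin N → ℤ) → ℝ → ℝ) (x : Fin N → ℤ) :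
    primitive f x 0 = 0 := by simp [primitive]

lemma gap_zero {N : ℕ} (p : ℝ) (f : (Fin N → ℤ) → ℝ → ℝ) (x : Fin N → ℤ) :
    gap p f x 0 = 0 := by
  simp [gap, primitive_zero]

namespace Assumptions

variable {N : ℕ} {p : ℝ} {T : ℕ} {V : (Fin N → ℤ) → ℝ} {f : (Fin N → ℤ) → ℝ → ℝ}

lemma p_pos (A : Assumptions N p T V f) : 0 < p := by linarith [A.hp]

lemma lt_pStar (A : Assumptions N p T V f) : p < pStar N p := (pStar_pos_aux A.hp A.hpN).1

lemma pStar_pos (A : Assumptions N p T V f) : 0 < pStar N p := A.p_pos.trans A.lt_pStar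

lemma small (A : Assumptions N p T V f)
    {ε : ℝ} (hε : 0 < ε) : ∃ δ > 0, ∀ x t, |t| < δ → |f x t * t| ≤ ε * |t| ^ pStar N p := by
  obtain ⟨δ, hδ, h⟩ := A.hzero ε hε
  refine ⟨δ, hδ, fun x t ht => ?_⟩
  rcases eq_or_ne t 0 with rfl | h0
  · simp [Real.zero_rpow A.pStar_pos.ne']
  have ht0 := abs_pos.2 h0
  rw [abs_mul]
  calc |f x t| * |t| ≤ ε * |t| ^ (pStar N p - 1) * |t| := by gcongr; exact h x t ht0 ht
    _ = ε * |t| ^ pStar N p := by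
      rw [mul_assoc, ← Real.rpow_add_one ht0.ne', sub_add_cancel]

lemma tendsto_ratio (A : Assumptions N p T V f) (x : Fin N → ℤ) :
    Tendsto (fun t : ℝ => f x t / |t| ^ (p - 1)) (𝓝[≠] 0) (𝓝 0) := by
  obtain ⟨δ, hδ, h⟩ := A.hzero 1 one_pos
  have hlim : Tendsto (fun t : ℝ => |t| ^ (pStar N p - p)) (𝓝[≠] 0) (𝓝 0) := by
    have hc : Continuous fun t : ℝ => |t| ^ (pStar N p - p) :=
      continuous_abs.rpow_const fun _ => Or.inr (by linarith [A.lt_pStar])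
    have := hc.tendsto 0
    rw [abs_zero, Real.zero_rpow (by linarith [A.lt_pStar])] at this
    exact this.mono_left nhdsWithin_le_nhds
  refine squeeze_zero_norm' ?_ hlim
  filter_upwards [self_mem_nhdsWithin, nhdsWithin_le_nhds (Metric.ball_mem_nhds 0 hδ)] with t h0 ht
  have ht0 : 0 < |t| := abs_pos.2 h0
  have ht1 : |t| < δ := by simpa using ht
  have hk := h x t ht0 ht1
  have hpow : 0 < |t| ^ (p - 1) := Real.rpow_pos_of_pos ht0 _
  rw [norm_div, Real.norm_eq_abs, Real.norm_of_nonneg hpow.le, div_le_iff₀ hpow,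
    ← Real.rpow_add ht0]
  refine hk.trans (le_of_eq ?_)
  rw [one_mul]; congr 1; ring

/-- The reflection `t ↦ -f (x, -t)` satisfies the hypotheses of `fibering_pos`, which thereby also
covers negative arguments. -/
lemma fibering_neg_aux (A : Assumptions N p T V f) (x : Fin N → ℤ) :
    StrictMonoOn (fun t : ℝ => -f x (-t) / |t| ^ (p - 1)) (Set.Ioi 0) ∧
      Tendsto (fun t : ℝ => -f x (-t) / |t| ^ (p - 1)) (𝓝[>] 0) (𝓝 0) := by
  constructor
  · intro s hs t ht hst
    have := A.hmono x (Or.inl (by simpa using ht) : -t ∈ Set.Iio 0 ∪ Set.Ioi 0)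
      (Or.inl (by simpa using hs) : -s ∈ Set.Iio 0 ∪ Set.Ioi 0) (neg_lt_neg hst)
    simp only [abs_neg] at this
    simp only [neg_div]
    linarith
  · have hn : Tendsto (fun t : ℝ => -t) (𝓝[>] 0) (𝓝[≠] 0) := by
      refine tendsto_nhdsWithin_iff.2 ⟨?_, ?_⟩
      · simpa using (continuous_neg.tendsto (0 : ℝ)).mono_left nhdsWithin_le_nhds
      · filter_upwards [self_mem_nhdsWithin] with t ht
        simpa using (ne_of_gt ht)
    have := ((A.tendsto_ratio x).comp hn).neg
    simpa [Function.comp_def, neg_div] using this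

/-- All pointwise consequences of monotonicity of `f (x, t) / |t| ^ (p - 1)`. -/
lemma fibering (A : Assumptions N p T V f) (x : Fin N → ℤ) {a : ℝ} (ha : a ≠ 0) :
    0 < f x a * a ∧ 0 ≤ primitive f x a ∧
      (∀ s, 0 < s → s < 1 → f x (s * a) * (s * a) < s ^ p * (f x a * a)) ∧
      ∀ s, 0 ≤ s → s ≠ 1 →
        (s ^ p - 1) / p * (f x a * a) < primitive f x (s * a) - primitive f x a := by
  rcases lt_or_gt_of_ne ha with h | h
  · obtain ⟨h1, h2⟩ := A.fibering_neg_aux x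
    have hc : Continuous fun t => -f x (-t) := ((A.hfcont x).comp continuous_neg).neg
    have e : ∀ b : ℝ, ∫ s in (0 : ℝ)..(-b), -f x (-s) = primitive f x b := fun b => by
      rw [intervalIntegral.integral_neg, intervalIntegral.integral_comp_neg, neg_neg, neg_zero,
        intervalIntegral.integral_symm, neg_neg, primitive]
    obtain ⟨k1, k2, k3, k4⟩ := fibering_pos A.hp hc h1 h2 (neg_pos.2 h)
    simp only [mul_neg, neg_neg, neg_mul, e] at k1 k2 k3 k4
    exact ⟨by nlinarith, k2, k3, k4⟩
  · obtain ⟨k1, k2, k3, k4⟩ := fibering_pos A.hp (A.hfcont x)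
      ((A.hmono x).mono Set.subset_union_right)
      ((A.tendsto_ratio x).mono_left (nhdsWithin_mono _ fun t ht => ne_of_gt ht)) h
    exact ⟨mul_pos k1 h, k2, k3, k4⟩

lemma f_mul_nonneg (A : Assumptions N p T V f) (x : Fin N → ℤ) (a : ℝ) : 0 ≤ f x a * a := by
  rcases eq_or_ne a 0 with rfl | h
  · simp
  · exact (A.fibering x h).1.le

lemma f_zero (A : Assumptions N p T V f) (x : Fin N → ℤ) : f x 0 = 0 := by
  have h1 : 0 ≤ f x 0 := by
    refine ge_of_tendsto ((A.hfcont x).continuousWithinAt (s := Set.Ioi 0) (x := 0)) ?_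
    filter_upwards [self_mem_nhdsWithin] with s hs
    exact (pos_of_mul_pos_left (A.fibering x (ne_of_gt hs)).1 (le_of_lt hs)).le
  have h2 : f x 0 ≤ 0 := by
    refine le_of_tendsto ((A.hfcont x).continuousWithinAt (s := Set.Iio 0) (x := 0)) ?_
    filter_upwards [self_mem_nhdsWithin] with s hs
    have := A.f_mul_nonneg x s
    have hs' : s < 0 := hs
    by_contra! h
    nlinarith
  exact le_antisymm h2 h1

lemma primitive_nonneg (A : Assumptions N p T V f)
    (x : Fin N → ℤ) (a : ℝ) : 0 ≤ primitive f x a := by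
  rcases eq_or_ne a 0 with rfl | h
  · rw [primitive_zero]
  · exact (A.fibering x h).2.1

/-- This is the fibering inequality at `s = 0`. -/
lemma gap_pos (A : Assumptions N p T V f)
    (x : Fin N → ℤ) {a : ℝ} (ha : a ≠ 0) : 0 < gap p f x a := by
  have := (A.fibering x ha).2.2.2 0 le_rfl zero_ne_one
  rw [zero_mul, primitive_zero, Real.zero_rpow A.p_pos.ne'] at this
  have e : (0 - 1) / p * (f x a * a) = -(f x a * a / p) := by ring
  rw [e] at this
  rw [gap]
  linarith

lemma gap_nonneg (A : Assumptions N p T V f) (x : Fin N → ℤ) (a : ℝ) : 0 ≤ gap p f x a := by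
  rcases eq_or_ne a 0 with rfl | h
  · rw [gap_zero]
  · exact (A.gap_pos x h).le

lemma primitive_le (A : Assumptions N p T V f)
    (x : Fin N → ℤ) (a : ℝ) : primitive f x a ≤ f x a * a / p := by
  have := A.gap_nonneg x a
  rw [gap] at this
  linarith

lemma gap_le (A : Assumptions N p T V f) (x : Fin N → ℤ) (a : ℝ) : gap p f x a ≤ f x a * a := by
  have h1 := A.primitive_nonneg x a
  have h2 : f x a * a / p ≤ f x a * a := div_le_self (A.f_mul_nonneg x a) A.hp.le
  rw [gap]
  linarith

lemma primitive_scale (A : Assumptions N p T V f) (x : Fin N → ℤ) (a : ℝ) {s : ℝ} (hs : 0 ≤ s) :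
    (s ^ p - 1) / p * (f x a * a) ≤ primitive f x (s * a) - primitive f x a := by
  rcases eq_or_ne a 0 with rfl | h
  · simp
  rcases eq_or_ne s 1 with rfl | h1
  · simp
  · exact ((A.fibering x h).2.2.2 s hs h1).le

/-- The terms in `f (x, a) a` from the two fibering inequalities cancel. Hence scaling down to the
Nehari manifold does not increase `∑ G`. -/
lemma gap_scale_le (A : Assumptions N p T V f)
    (x : Fin N → ℤ) (a : ℝ) {s : ℝ} (hs : 0 ≤ s) (hs1 : s ≤ 1) :
    gap p f x (s * a) ≤ gap p f x a := by
  rcases eq_or_ne a 0 with rfl | h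
  · simp
  rcases hs.eq_or_lt with rfl | hs0
  · rw [zero_mul, gap_zero]; exact A.gap_nonneg x a
  rcases hs1.eq_or_lt with rfl | hs1
  · rw [one_mul]
  have h1 := ((A.fibering x h).2.2.1 s hs0 hs1).le
  have h2 := A.primitive_scale x a hs
  have h3 := div_le_div_of_nonneg_right h1 A.p_pos.le
  have e : (s ^ p - 1) / p * (f x a * a) = s ^ p * (f x a * a) / p - f x a * a / p := by ring
  rw [gap, gap]
  linarith

lemma hasDerivAt_primitive (A : Assumptions N p T V f)
    (x : Fin N → ℤ) (t : ℝ) : HasDerivAt (primitive f x) (f x t) t :=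
  intervalIntegral.integral_hasDerivAt_right ((A.hfcont x).intervalIntegrable _ _)
    (A.hfcont x).stronglyMeasurable.stronglyMeasurableAtFilter (A.hfcont x).continuousAt

lemma continuous_primitive (A : Assumptions N p T V f)
    (x : Fin N → ℤ) : Continuous (primitive f x) :=
  continuous_iff_continuousAt.2 fun t => (A.hasDerivAt_primitive x t).continuousAt

lemma continuous_mul (A : Assumptions N p T V f) (x : Fin N → ℤ) : Continuous fun t => f x t * t :=
  (A.hfcont x).mul continuous_id

lemma continuous_gap (A : Assumptions N p T V f) (x : Fin N → ℤ) : Continuous (gap p f x) :=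
  ((A.continuous_mul x).div_const p).sub (A.continuous_primitive x)

/-- Near `0` this is smallness of `f`; away from `0` a uniform bound is divided by `δ ^ p^*`.
Elements of `E` are bounded, so all series in `f` are dominated by `∑ |u| ^ p^*`. -/
lemma local_bound (A : Assumptions N p T V f)
    (M : ℝ) : ∃ C ≥ 0, ∀ x t, |t| ≤ M → |f x t * t| ≤ C * |t| ^ pStar N p := by
  obtain ⟨δ, hδ, h⟩ := A.small one_pos
  obtain ⟨C, hC0, hC⟩ := A.hfper.bounded A.hT A.hfcont M
  have hs := A.pStar_pos
  have hM : 0 ≤ max M 0 := le_max_right _ _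
  have hK : 0 ≤ C * max M 0 / δ ^ pStar N p := by positivity
  refine ⟨C * max M 0 / δ ^ pStar N p + 1, by linarith, fun x t ht => ?_⟩
  have ht' : 0 ≤ |t| ^ pStar N p := by positivity
  rcases lt_or_ge |t| δ with h1 | h1
  · have := h x t h1
    have := mul_nonneg hK ht'
    linarith
  · have h2 : |f x t * t| ≤ C * max M 0 := by
      rw [abs_mul]
      exact mul_le_mul (hC x t ht) (ht.trans (le_max_left _ _)) (abs_nonneg _) hC0
    have h3 : δ ^ pStar N p ≤ |t| ^ pStar N p := by gcongr
    have h4 : C * max M 0 = C * max M 0 / δ ^ pStar N p * δ ^ pStar N p := by field_simp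
    have h5 := mul_le_mul_of_nonneg_left h3 hK
    linarith

lemma split_f_mul (A : Assumptions N p T V f)
    (M : ℝ) {ε : ℝ} (hε : 0 < ε) : ∃ C, ∀ x a b, |a| ≤ M → |b| ≤ M →
    |f x (a + b) * (a + b) - f x a * a - f x b * b| ≤
      ε * |a| ^ pStar N p + C * |b| ^ pStar N p := by
  refine split_of_isLittleO (h := fun x t => f x t * t) A.pStar_pos (fun ε hε => A.small hε)
    A.local_bound (fun M ε hε => ?_) M hε
  exact IsPeriodic.equicontinuous A.hT (fun x i => by simp only [A.hfper x i])
    A.continuous_mul M hε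

/-- Because `0 ≤ G ≤ f t`, smallness at `0` and the local bound pass from `f t` to `G`. -/
lemma split_gap (A : Assumptions N p T V f)
    (M : ℝ) {ε : ℝ} (hε : 0 < ε) : ∃ C, ∀ x a b, |a| ≤ M → |b| ≤ M →
    |gap p f x (a + b) - gap p f x a - gap p f x b| ≤
      ε * |a| ^ pStar N p + C * |b| ^ pStar N p := by
  have hle : ∀ x t, |gap p f x t| ≤ |f x t * t| := fun x t => by
    rw [abs_of_nonneg (A.gap_nonneg x t), abs_of_nonneg (A.f_mul_nonneg x t)]
    exact A.gap_le x t
  refine split_of_isLittleO (h := gap p f) A.pStar_pos (fun ε hε => ?_) (fun M => ?_)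
    (fun M ε hε => ?_) M hε
  · obtain ⟨δ, hδ, h⟩ := A.small hε
    exact ⟨δ, hδ, fun x t ht => (hle x t).trans (h x t ht)⟩
  · obtain ⟨C, hC, h⟩ := A.local_bound M
    exact ⟨C, hC, fun x t ht => (hle x t).trans (h x t ht)⟩
  · refine IsPeriodic.equicontinuous A.hT (fun x i => ?_) A.continuous_gap M hε
    ext t
    simp only [gap, primitive, A.hfper x i]

end Assumptions

/-! ### The Nehari functional along rays and projection onto the manifold. -/

/-- The Nehari functional `⟨Φ'(u), u⟩ = ‖u‖ ^ p - ∑_x f (x, u x) u x`. -/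
noncomputable def nehariFn {N : ℕ} (p : ℝ) (V : (Fin N → ℤ) → ℝ) (f : (Fin N → ℤ) → ℝ → ℝ)
    (u : (Fin N → ℤ) → ℝ) : ℝ :=
  normPow p V u - ∑' x, f x (u x) * u x

lemma abs_rpow_sub_two_mul {p : ℝ} (hp : 0 < p) (a : ℝ) : |a| ^ (p - 2) * a * a = |a| ^ p := by
  rcases eq_or_ne a 0 with rfl | h
  · simp [Real.zero_rpow hp.ne']
  · rw [mul_assoc, ← pow_two, ← sq_abs, ← Real.rpow_natCast, ← Real.rpow_add (abs_pos.2 h)]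
    congr 1
    push_cast; ring

lemma energyDeriv_self {N : ℕ} {p : ℝ} (hp : 0 < p) (V : (Fin N → ℤ) → ℝ)
    (f : (Fin N → ℤ) → ℝ → ℝ) (u : (Fin N → ℤ) → ℝ) :
    energyDeriv p V f u u = nehariFn p V f u := by
  simp only [energyDeriv, nehariFn, normPow, abs_rpow_sub_two_mul hp]
  congr 3
  ext x
  rw [mul_assoc, mul_assoc, ← mul_assoc (|u x| ^ (p - 2)), abs_rpow_sub_two_mul hp]

namespace Assumptions

variable {N : ℕ} {p : ℝ} {T : ℕ} {V : (Fin N → ℤ) → ℝ} {f : (Fin N → ℤ) → ℝ → ℝ}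

lemma mem_nehari (A : Assumptions N p T V f) {u : (Fin N → ℤ) → ℝ} :
    u ∈ nehari p V f ↔ InE p V u ∧ u ≠ 0 ∧ nehariFn p V f u = 0 := by
  rw [← energyDeriv_self A.p_pos, ← mem_E_iff A.hp A.hpN A.hV]
  rfl

lemma summable_rpow (A : Assumptions N p T V f) {u : (Fin N → ℤ) → ℝ} (hu : InE p V u) :
    Summable fun x => |u x| ^ pStar N p := by
  obtain ⟨K, -, hK⟩ := sobolev A.hp A.hpN A.hV
  exact (hK u hu).1

lemma exists_rpow_bound (A : Assumptions N p T V f)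
    (M : ℝ) : ∃ C, ∀ u, InE p V u → normPow p V u ≤ M →
    ∑' x, |u x| ^ pStar N p ≤ C := by
  obtain ⟨K, hK0, hK⟩ := sobolev A.hp A.hpN A.hV
  refine ⟨K * M ^ (pStar N p / p), fun u hu hM => (hK u hu).2.trans ?_⟩
  have := normPow_nonneg (p := p) A.hV u
  have := A.pStar_pos
  have := A.p_pos
  gcongr

lemma exists_sup_bound (A : Assumptions N p T V f)
    (M : ℝ) : ∃ B ≥ 0, ∀ u, InE p V u → normPow p V u ≤ M → ∀ x, |u x| ≤ B := by
  obtain ⟨C, hC⟩ := A.exists_rpow_bound M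
  have hs := A.pStar_pos
  refine ⟨max C 0 ^ (1 / pStar N p), by positivity, fun u hu hM x => ?_⟩
  have h1 := ((A.summable_rpow hu).le_tsum x fun _ _ => by positivity).trans (hC u hu hM)
  have h2 := Real.rpow_le_rpow (by positivity) (h1.trans (le_max_left C 0))
    (by positivity : 0 ≤ 1 / pStar N p)
  rwa [← Real.rpow_mul (abs_nonneg _), mul_one_div_cancel hs.ne', Real.rpow_one] at h2

lemma summable_f_mul (A : Assumptions N p T V f) {u : (Fin N → ℤ) → ℝ} (hu : InE p V u) :
    Summable fun x => f x (u x) * u x := by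
  obtain ⟨B, -, hB⟩ := A.exists_sup_bound (normPow p V u)
  obtain ⟨C, -, hC⟩ := A.local_bound B
  exact Summable.of_norm_bounded ((A.summable_rpow hu).mul_left C)
    fun x => hC x _ (hB u hu le_rfl x)

lemma summable_primitive (A : Assumptions N p T V f) {u : (Fin N → ℤ) → ℝ} (hu : InE p V u) :
    Summable fun x => primitive f x (u x) :=
  Summable.of_nonneg_of_le (fun x => A.primitive_nonneg x _) (fun x => A.primitive_le x _)
    ((A.summable_f_mul hu).div_const p)

lemma summable_gap (A : Assumptions N p T V f)
    {u : (Fin N → ℤ) → ℝ} (hu : InE p V u) : Summable fun x => gap p f x (u x) :=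
  ((A.summable_f_mul hu).div_const p).sub (A.summable_primitive hu)

/-- On the manifold the first term vanishes and the energy becomes a series of nonnegative terms, to
which Fatou's lemma applies. -/
lemma energy_eq (A : Assumptions N p T V f) {u : (Fin N → ℤ) → ℝ} (hu : InE p V u) :
    energy p V f u = nehariFn p V f u / p + ∑' x, gap p f x (u x) := by
  simp only [gap]
  rw [((A.summable_f_mul hu).div_const p).tsum_sub (A.summable_primitive hu), tsum_div_const,
    energy, nehariFn]
  ring

lemma energy_eq_gap (A : Assumptions N p T V f) {u : (Fin N → ℤ) → ℝ} (hu : u ∈ nehari p V f) :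
    energy p V f u = ∑' x, gap p f x (u x) := by
  obtain ⟨h, -, h0⟩ := A.mem_nehari.1 hu
  rw [A.energy_eq h, h0, zero_div, zero_add]

lemma energy_nonneg (A : Assumptions N p T V f)
    {u : (Fin N → ℤ) → ℝ} (hu : u ∈ nehari p V f) : 0 ≤ energy p V f u := by
  rw [A.energy_eq_gap hu]
  exact tsum_nonneg fun x => A.gap_nonneg x _

/-- Sum the fibering inequality over the lattice and replace `∑ f (x, u) u` by `‖u‖ ^ p`. It is
strict at any vertex where `u` does not vanish. -/
lemma energy_smul_lt (A : Assumptions N p T V f)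
    {u : (Fin N → ℤ) → ℝ} (hu : u ∈ nehari p V f) {s : ℝ} (hs : 0 ≤ s)
    (hs1 : s ≠ 1) : energy p V f (s • u) < energy p V f u := by
  obtain ⟨h, h0, hn⟩ := A.mem_nehari.1 hu
  obtain ⟨x₀, hx₀⟩ := Function.ne_iff.1 h0
  have k1 := (A.summable_f_mul h).mul_left ((s ^ p - 1) / p)
  have k2 := (A.summable_primitive (h.smul s)).sub (A.summable_primitive h)
  have key := k1.tsum_lt_tsum (i := x₀)
    (g := fun x => primitive f x ((s • u) x) - primitive f x (u x)) (fun x => A.primitive_scale x (u x) hs)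
    ((A.fibering x₀ hx₀).2.2.2 s hs hs1) k2
  rw [tsum_mul_left, (A.summable_primitive (h.smul s)).tsum_sub (A.summable_primitive h)] at key
  rw [nehariFn, sub_eq_zero] at hn
  rw [← hn] at key
  rw [energy, energy, normPow_smul, abs_of_nonneg hs]
  have e : (s ^ p - 1) / p * normPow p V u =
    1 / p * (s ^ p * normPow p V u) - 1 / p * normPow p V u := by ring
  rw [e] at key
  linarith

lemma energy_smul_le (A : Assumptions N p T V f)
    {u : (Fin N → ℤ) → ℝ} (hu : u ∈ nehari p V f) {s : ℝ} (hs : 0 ≤ s) :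
    energy p V f (s • u) ≤ energy p V f u := by
  rcases eq_or_ne s 1 with rfl | h
  · rw [one_smul]
  · exact (A.energy_smul_lt hu hs h).le

lemma nehariFn_smul_pos (A : Assumptions N p T V f)
    {u : (Fin N → ℤ) → ℝ} (hu : u ∈ nehari p V f) {s : ℝ} (hs : 0 < s)
    (hs1 : s < 1) : 0 < nehariFn p V f (s • u) := by
  obtain ⟨h, h0, hn⟩ := A.mem_nehari.1 hu
  obtain ⟨x₀, hx₀⟩ := Function.ne_iff.1 h0
  have key := (A.summable_f_mul (h.smul s)).tsum_lt_tsum (i := x₀)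
    (g := fun x => s ^ p * (f x (u x) * u x)) (fun x => ?_)
    ((A.fibering x₀ hx₀).2.2.1 s hs hs1) ((A.summable_f_mul h).mul_left _)
  · rw [nehariFn, sub_eq_zero] at hn
    rw [tsum_mul_left, ← hn] at key
    rw [nehariFn, normPow_smul, abs_of_pos hs]
    linarith
  · rcases eq_or_ne (u x) 0 with e | e
    · simp [e]
    · exact ((A.fibering x e).2.2.1 s hs hs1).le

lemma nehariFn_smul_neg (A : Assumptions N p T V f)
    {u : (Fin N → ℤ) → ℝ} (hu : u ∈ nehari p V f) {s : ℝ} (hs : 1 < s) :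
    nehariFn p V f (s • u) < 0 := by
  obtain ⟨h, h0, hn⟩ := A.mem_nehari.1 hu
  obtain ⟨x₀, hx₀⟩ := Function.ne_iff.1 h0
  have hs0 : 0 < s := by linarith
  have hlt : ∀ x, u x ≠ 0 → s ^ p * (f x (u x) * u x) < f x (s * u x) * (s * u x) := by
    intro x hx
    -- The case `s > 1` follows from the case of a factor below `1` with base point `s u x` and
    -- factor `1 / s`.
    have := (A.fibering x (mul_ne_zero hs0.ne' hx)).2.2.1 (1 / s) (by positivity)
      ((div_lt_one hs0).2 hs)
    rw [one_div, inv_mul_cancel_left₀ hs0.ne', Real.inv_rpow hs0.le] at this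
    have hsp : 0 < s ^ p := by positivity
    calc s ^ p * (f x (u x) * u x) < s ^ p * ((s ^ p)⁻¹ * (f x (s * u x) * (s * u x))) := by
          gcongr
      _ = _ := by field_simp
  have key := ((A.summable_f_mul h).mul_left (s ^ p)).tsum_lt_tsum (i := x₀)
    (g := fun x => f x ((s • u) x) * (s • u) x) (fun x => ?_)
    (hlt x₀ hx₀) (A.summable_f_mul (h.smul s))
  · rw [nehariFn, sub_eq_zero] at hn
    rw [tsum_mul_left, ← hn] at key
    rw [nehariFn, normPow_smul, abs_of_pos hs0]
    linarith
  · rcases eq_or_ne (u x) 0 with e | e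
    · simp [e]
    · exact (hlt x e).le

lemma continuousOn_nehariFn_smul (A : Assumptions N p T V f)
    {u : (Fin N → ℤ) → ℝ} (hu : InE p V u) (R : ℝ) :
    ContinuousOn (fun t : ℝ => nehariFn p V f (t • u)) (Set.Icc 0 R) := by
  obtain ⟨B, hB0, hB⟩ := A.exists_sup_bound (normPow p V u)
  obtain ⟨C, hC0, hC⟩ := A.local_bound (R * B)
  have hs := A.pStar_pos
  refine ContinuousOn.sub ?_ ?_
  · simp only [normPow_smul]
    exact ((continuous_abs.rpow_const fun _ => Or.inr A.p_pos.le).mul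
      continuous_const).continuousOn
  · refine continuousOn_tsum (u := fun x => C * (R ^ pStar N p * |u x| ^ pStar N p)) (fun x => ?_)
      (((A.summable_rpow hu).mul_left _).mul_left C) fun x t ht => ?_
    · exact ((A.continuous_mul x).comp (continuous_id.mul continuous_const)).continuousOn
    · have hR : 0 ≤ R := ht.1.trans ht.2
      have h1 : |t * u x| ≤ R * |u x| := by
        rw [abs_mul, abs_of_nonneg ht.1]
        exact mul_le_mul_of_nonneg_right ht.2 (abs_nonneg _)
      refine (hC x (t * u x) (h1.trans ?_)).trans ?_
      · exact mul_le_mul_of_nonneg_left (hB u hu le_rfl x) hR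
      · rw [← Real.mul_rpow hR (abs_nonneg _)]
        gcongr

/-- For small `t` the nonlinear term is at most `t ^ p^* ∑ |u| ^ p^*`, which `t ^ p ‖u‖ ^ p` beats
because `p < p^*`. -/
lemma exists_small_scale (A : Assumptions N p T V f)
    {u : (Fin N → ℤ) → ℝ} (hu : InE p V u) (h0 : u ≠ 0) :
    ∃ t : ℝ, 0 < t ∧ t < 1 ∧ 0 < nehariFn p V f (t • u) := by
  obtain ⟨B, hB0, hB⟩ := A.exists_sup_bound (normPow p V u)
  obtain ⟨δ, hδ, h⟩ := A.small one_pos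
  have hA := normPow_pos A.hp A.hpN A.hV hu h0
  have hr : 0 < pStar N p - p := sub_pos.2 A.lt_pStar
  set S := ∑' x, |u x| ^ pStar N p
  have l1 : ∀ᶠ t in 𝓝[>] (0 : ℝ), t * B < δ := by
    have : Tendsto (fun t : ℝ => t * B) (𝓝[>] 0) (𝓝 (0 * B)) :=
      (tendsto_id.mono_left nhdsWithin_le_nhds).mul_const B
    rw [zero_mul] at this
    exact this.eventually_lt_const hδ
  have l2 : ∀ᶠ t in 𝓝[>] (0 : ℝ), t ^ (pStar N p - p) * S < normPow p V u := by
    have : Tendsto (fun t : ℝ => t ^ (pStar N p - p) * S) (𝓝[>] 0)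
        (𝓝 (0 ^ (pStar N p - p) * S)) :=
      ((tendsto_id.mono_left nhdsWithin_le_nhds).rpow_const (Or.inr hr.le)).mul_const S
    rw [Real.zero_rpow hr.ne', zero_mul] at this
    exact this.eventually_lt_const hA
  obtain ⟨t, ⟨⟨ht1, ht2⟩, ht3⟩⟩ := ((l1.and l2).and (Ioo_mem_nhdsGT (one_pos (α := ℝ)))).exists
  refine ⟨t, ht3.1, ht3.2, ?_⟩
  have ht := ht3.1
  have hle : ∑' x, f x ((t • u) x) * (t • u) x ≤ ∑' x, t ^ pStar N p * |u x| ^ pStar N p := by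
    refine (A.summable_f_mul (hu.smul t)).tsum_le_tsum (fun x => ?_)
      ((A.summable_rpow hu).mul_left _)
    refine (le_abs_self _).trans ((h x (t * u x) ?_).trans (le_of_eq ?_))
    · rw [abs_mul, abs_of_pos ht]
      exact (mul_le_mul_of_nonneg_left (hB u hu le_rfl x) ht.le).trans_lt ht1
    · rw [one_mul, abs_mul, abs_of_pos ht, Real.mul_rpow ht.le (abs_nonneg _)]
  rw [tsum_mul_left] at hle
  rw [nehariFn, normPow_smul, abs_of_pos ht]
  have e : t ^ pStar N p * S = t ^ p * (t ^ (pStar N p - p) * S) := by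
    rw [← mul_assoc, ← Real.rpow_add ht]; congr 2; ring
  have : t ^ p * (t ^ (pStar N p - p) * S) < t ^ p * normPow p V u := by gcongr
  linarith

lemma exists_large_scale (A : Assumptions N p T V f)
    {u : (Fin N → ℤ) → ℝ} (hu : InE p V u) (h0 : u ≠ 0) :
    ∃ t : ℝ, 0 < t ∧ nehariFn p V f (t • u) ≤ 0 := by
  obtain ⟨x₀, hx₀⟩ := Function.ne_iff.1 h0
  have hx : 0 < |u x₀| := abs_pos.2 hx₀
  -- One vertex suffices: with this threshold, `F` at `x₀` alone exceeds `t ^ p ‖u‖ ^ p`.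
  obtain ⟨R, hR, h⟩ := A.hsuper (normPow p V u / |u x₀| ^ p)
  refine ⟨(R + 1) / |u x₀|, by positivity, ?_⟩
  set t := (R + 1) / |u x₀| with htdef
  have ht : 0 < t := by positivity
  have h1 : |t * u x₀| = R + 1 := by
    rw [abs_mul, abs_of_pos ht, htdef, div_mul_cancel₀ _ hx.ne']
  have h2 := h x₀ (t * u x₀) (by rw [h1]; linarith)
  rw [abs_mul, abs_of_pos ht, Real.mul_rpow ht.le hx.le,
    div_le_div_iff₀ (by positivity) (by positivity)] at h2
  have h3 : t ^ p * normPow p V u ≤ primitive f x₀ (t * u x₀) := by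
    have : 0 < |u x₀| ^ p := by positivity
    nlinarith
  have h4 := (A.summable_f_mul (hu.smul t)).le_tsum x₀ fun x _ => A.f_mul_nonneg x _
  have h5 := A.primitive_le x₀ (t * u x₀)
  have h6 : f x₀ (t * u x₀) * (t * u x₀) / p ≤ f x₀ (t * u x₀) * (t * u x₀) :=
    div_le_self (A.f_mul_nonneg x₀ _) A.hp.le
  rw [nehariFn, normPow_smul, abs_of_pos ht]
  simp only [Pi.smul_apply, smul_eq_mul] at h4 ⊢
  linarith

/-- Functions with nonpositive Nehari functional can be scaled down to the Nehari manifold. -/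
lemma exists_scale_le_one (A : Assumptions N p T V f)
    {u : (Fin N → ℤ) → ℝ} (hu : InE p V u) (h0 : u ≠ 0)
    (hn : nehariFn p V f u ≤ 0) : ∃ t : ℝ, 0 < t ∧ t ≤ 1 ∧ t • u ∈ nehari p V f := by
  obtain ⟨s, hs0, hs1, hs⟩ := A.exists_small_scale hu h0
  have hc := (A.continuousOn_nehariFn_smul hu 1).mono (Set.Icc_subset_Icc_left hs0.le)
  obtain ⟨t, ht, hte⟩ := intermediate_value_Icc' hs1.le hc
    (show (0 : ℝ) ∈ _ from ⟨by simpa using hn, hs.le⟩)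
  have ht0 : 0 < t := hs0.trans_le ht.1
  exact ⟨t, ht0, ht.2, A.mem_nehari.2 ⟨hu.smul t, smul_ne_zero ht0.ne' h0, hte⟩⟩

lemma exists_scale (A : Assumptions N p T V f) {u : (Fin N → ℤ) → ℝ} (hu : InE p V u) (h0 : u ≠ 0) :
    ∃ t : ℝ, 0 < t ∧ t • u ∈ nehari p V f := by
  obtain ⟨s, hs, hn⟩ := A.exists_large_scale hu h0
  obtain ⟨t, ht, -, h⟩ := A.exists_scale_le_one (hu.smul s) (smul_ne_zero hs.ne' h0) hn
  exact ⟨t * s, mul_pos ht hs, by rwa [mul_smul]⟩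

end Assumptions

/-! ### Bounds on the Nehari manifold and existence of a ground state. -/

namespace Assumptions

variable {N : ℕ} {p : ℝ} {T : ℕ} {V : (Fin N → ℤ) → ℝ} {f : (Fin N → ℤ) → ℝ → ℝ}

/-- Sublevel sets of the energy on the Nehari manifold are bounded. -/
lemma exists_normPow_bound (A : Assumptions N p T V f) (a : ℝ) :
    ∃ M, ∀ u ∈ nehari p V f, energy p V f u ≤ a → normPow p V u ≤ M := by
  obtain ⟨C, hC⟩ := A.exists_rpow_bound 1
  have hp := A.p_pos
  have hps := A.pStar_pos
  -- For `v` of norm one, `‖s v‖ ^ p / p = |a| + 2`. The choice of `ε` below makes `∑ F (x, s v) ≤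
  -- 1` whenever `s v` is uniformly small, so that `Φ (s v) > a`.
  set s : ℝ := (p * (|a| + 2)) ^ (1 / p) with hs
  have hs0 : 0 < s := by positivity
  have hsp : s ^ p = p * (|a| + 2) := by
    rw [hs, ← Real.rpow_mul (by positivity), one_div_mul_cancel hp.ne', Real.rpow_one]
  set ε : ℝ := 1 / (s ^ pStar N p * (|C| + 1)) with hεdef
  have hε : 0 < ε := by positivity
  obtain ⟨δ, hδ, hsmall⟩ := A.small hε
  set κ := δ / s with hκ
  have hκ0 : 0 < κ := by positivity
  obtain ⟨R, hR, hsup⟩ := A.hsuper (1 / κ ^ p)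
  refine ⟨(R / κ) ^ p, fun u hu hua => ?_⟩
  obtain ⟨hE, h0, -⟩ := A.mem_nehari.1 hu
  have hn := normPow_pos A.hp A.hpN A.hV hE h0
  set n := normPow p V u ^ (1 / p) with hndef
  have hn0 : 0 < n := by positivity
  have hnp : n ^ p = normPow p V u := by
    rw [hndef, ← Real.rpow_mul hn.le, one_div_mul_cancel hp.ne', Real.rpow_one]
  have hv1 : normPow p V (n⁻¹ • u) = 1 := by
    rw [normPow_smul, abs_of_pos (by positivity), Real.inv_rpow hn0.le, hnp, inv_mul_cancel₀ hn.ne']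
  have hvE := hE.smul n⁻¹
  -- Otherwise `s u / n` is uniformly below `δ` and its energy exceeds `a`, although `u` maximises
  -- the energy on its ray.
  obtain ⟨x, hx⟩ : ∃ x, n * κ ≤ |u x| := by
    by_contra! hcon
    have hlt : ∀ x, |(s • n⁻¹ • u) x| < δ := fun x => by
      have h1 := hcon x
      simp only [Pi.smul_apply, smul_eq_mul, abs_mul, abs_of_pos hs0,
        abs_of_pos (inv_pos.2 hn0)]
      calc s * (n⁻¹ * |u x|) < s * (n⁻¹ * (n * κ)) := by gcongr
        _ = δ := by rw [hκ]; field_simp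
    have hsum : ∑' x, primitive f x ((s • n⁻¹ • u) x) ≤ 1 := by
      calc _ ≤ ∑' x, ε * s ^ pStar N p * |(n⁻¹ • u) x| ^ pStar N p := by
            refine (A.summable_primitive (hvE.smul s)).tsum_le_tsum (fun x => ?_)
              ((A.summable_rpow hvE).mul_left _)
            refine (A.primitive_le x _).trans ((div_le_self (A.f_mul_nonneg x _) A.hp.le).trans
              ((le_abs_self _).trans ((hsmall x _ (hlt x)).trans (le_of_eq ?_))))
            rw [Pi.smul_apply, smul_eq_mul, abs_mul, abs_of_pos hs0,
              Real.mul_rpow hs0.le (abs_nonneg _), mul_assoc]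
        _ = ε * s ^ pStar N p * ∑' x, |(n⁻¹ • u) x| ^ pStar N p := tsum_mul_left
        _ ≤ ε * s ^ pStar N p * (|C| + 1) := by
            gcongr
            linarith [hC _ hvE hv1.le, le_abs_self C]
        _ = 1 := by rw [hεdef]; field_simp
    have he : energy p V f (s • n⁻¹ • u) ≤ a := by
      rw [smul_smul]
      exact (A.energy_smul_le hu (by positivity)).trans hua
    rw [energy, normPow_smul, hv1, abs_of_pos hs0, hsp] at he
    have e : 1 / p * (p * (|a| + 2) * 1) = |a| + 2 := by field_simp
    rw [e] at he
    linarith [le_abs_self a]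
  rw [← hnp]
  refine Real.rpow_le_rpow hn0.le ?_ hp.le
  -- If `n > R / κ`, superlinearity at `x` gives `F (x, u x) ≥ ‖u‖ ^ p > ‖u‖ ^ p / p`, so the energy
  -- would be negative.
  by_contra! hlt
  rw [div_lt_iff₀ hκ0] at hlt
  have h1 := hsup x (u x) (hlt.trans_le hx)
  have hux : 0 < |u x| := hR.trans (hlt.trans_le hx)
  rw [div_le_div_iff₀ (by positivity) (by positivity), one_mul] at h1
  have h2 : n ^ p * κ ^ p ≤ |u x| ^ p := by
    rw [← Real.mul_rpow hn0.le hκ0.le]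
    gcongr
  have h3 : normPow p V u ≤ primitive f x (u x) := by
    rw [← hnp]
    exact le_of_mul_le_mul_right (h2.trans h1) (by positivity)
  have h4 := (A.summable_primitive hE).le_tsum x fun y _ => A.primitive_nonneg y _
  have h5 := A.energy_nonneg hu
  have h6 : 1 / p * normPow p V u < normPow p V u := by
    have : 1 / p < 1 := (div_lt_one hp).2 A.hp
    nlinarith
  rw [energy] at h5
  linarith

/-- Bounded elements of the Nehari manifold do not vanish uniformly. -/
lemma exists_lower_bound (A : Assumptions N p T V f) (M : ℝ) :
    ∃ δ > 0, ∀ u ∈ nehari p V f, normPow p V u ≤ M → ∃ x, δ ≤ |u x| := by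
  obtain ⟨K, hK, hS⟩ := sobolev A.hp A.hpN A.hV
  have hp := A.p_pos
  have hr : 0 < pStar N p / p - 1 := by
    rw [sub_pos, one_lt_div hp]; exact A.lt_pStar
  set L := (max M 0) ^ (pStar N p / p - 1) with hL
  have hL0 : 0 ≤ L := by positivity
  -- With this constant, `|u| < δ` everywhere would give `‖u‖ ^ p ≤ ‖u‖ ^ p / 2` through Sobolev's
  -- inequality.
  obtain ⟨δ, hδ, hsmall⟩ := A.small (ε := 1 / (2 * (K * (L + 1)))) (by positivity)
  refine ⟨δ, hδ, fun u hu hM => ?_⟩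
  by_contra! hcon
  obtain ⟨hE, h0, hn0⟩ := A.mem_nehari.1 hu
  have hn := normPow_pos A.hp A.hpN A.hV hE h0
  rw [nehariFn, sub_eq_zero] at hn0
  have h1 : ∑' x, f x (u x) * u x ≤ ∑' x, 1 / (2 * (K * (L + 1))) * |u x| ^ pStar N p :=
    (A.summable_f_mul hE).tsum_le_tsum
      (fun x => (le_abs_self _).trans (hsmall x _ (hcon x))) ((A.summable_rpow hE).mul_left _)
  rw [tsum_mul_left, ← hn0] at h1
  have h2 : normPow p V u ^ (pStar N p / p) ≤ normPow p V u * (L + 1) := by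
    have e : pStar N p / p = 1 + (pStar N p / p - 1) := by ring
    rw [e, Real.rpow_add hn, Real.rpow_one]
    gcongr
    have : normPow p V u ^ (pStar N p / p - 1) ≤ L := by
      rw [hL]
      gcongr
      exact hM.trans (le_max_left _ _)
    linarith
  have h3 : normPow p V u ≤ normPow p V u / 2 := by
    calc normPow p V u ≤ 1 / (2 * (K * (L + 1))) * ∑' x, |u x| ^ pStar N p := h1
      _ ≤ 1 / (2 * (K * (L + 1))) * (K * (normPow p V u * (L + 1))) := by
          gcongr
          exact (hS u hE).2.trans (by gcongr)
      _ = normPow p V u / 2 := by field_simp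
  linarith

/-- The Brezis–Lieb lemma is applied separately to the series over edges and over vertices. -/
lemma tendsto_normPow_split (A : Assumptions N p T V f)
    {w : ℕ → (Fin N → ℤ) → ℝ} {u : (Fin N → ℤ) → ℝ} {M : ℝ}
    (hw : ∀ n, InE p V (w n)) (hu : InE p V u) (hM : ∀ n, normPow p V (w n) ≤ M)
    (ht : ∀ x, Tendsto (fun n => w n x) atTop (𝓝 0)) :
    Tendsto (fun n => normPow p V (w n + u) - normPow p V (w n) - normPow p V u) atTop (𝓝 0) := by
  have hp := A.p_pos
  have hr : Continuous fun t : ℝ => |t| ^ p := continuous_abs.rpow_const fun _ => Or.inr hp.le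
  have hlim : ∀ (g : ℕ → ℝ) (b : ℝ), Tendsto g atTop (𝓝 0) →
      Tendsto (fun n => |g n + b| ^ p - |g n| ^ p - |b| ^ p) atTop (𝓝 0) := by
    intro g b hg
    have h1 := (hr.tendsto (0 + b)).comp (hg.add_const b)
    have h2 := (hr.tendsto 0).comp hg
    have := (h1.sub h2).sub_const (|b| ^ p)
    simpa [Function.comp_def, Real.zero_rpow hp.ne'] using this
  have hsum := fun n => ((hw n).add hp.le A.hV hu).1
  have t1 := tendsto_tsum_of_almost_dominated
    (D := fun n (d : (lattice N).Dart) => |(w n d.snd - w n d.fst) + (u d.snd - u d.fst)| ^ p -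
      |w n d.snd - w n d.fst| ^ p - |u d.snd - u d.fst| ^ p)
    (φ := fun n (d : (lattice N).Dart) => |w n d.snd - w n d.fst| ^ p) (K := 2 * M)
    (fun _ _ => by positivity) (fun n => (hw n).grad) (fun n => ?_) hu.grad
    (fun ε hε => ?_) (fun d => hlim _ _ (by simpa using (ht d.snd).sub (ht d.fst)))
  · have t2 := tendsto_tsum_of_almost_dominated
      (D := fun n x => V x * (|w n x + u x| ^ p - |w n x| ^ p - |u x| ^ p))
      (φ := fun n x => V x * |w n x| ^ p) (K := M)
      (fun _ x => mul_nonneg (A.hV x) (by positivity)) (fun n => (hw n).pot) (fun n => ?_) hu.pot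
      (fun ε hε => ?_) (fun x => by simpa using (hlim _ (u x) (ht x)).const_mul (V x))
    · have := (t1.const_mul (1 / 2)).add t2
      rw [mul_zero, add_zero] at this
      refine this.congr fun n => ?_
      have g1 : (fun d : (lattice N).Dart =>
          |(w n d.snd - w n d.fst) + (u d.snd - u d.fst)| ^ p) =
          fun d => |(w n + u) d.snd - (w n + u) d.fst| ^ p := by
        ext d; simp only [Pi.add_apply]; congr 2; ring
      have g2 : Summable fun d : (lattice N).Dart =>
          |(w n d.snd - w n d.fst) + (u d.snd - u d.fst)| ^ p := by
        rw [g1]; exact (hsum n).grad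
      rw [(g2.sub (hw n).grad).tsum_sub hu.grad, g2.tsum_sub (hw n).grad, g1]
      simp only [mul_sub]
      have g3 : Summable fun x => V x * |w n x + u x| ^ p := (hsum n).pot
      rw [(g3.sub (hw n).pot).tsum_sub hu.pot, g3.tsum_sub (hw n).pot]
      simp only [normPow, tsum_mul_left, Pi.add_apply]
      ring
    · have := gradPow_nonneg (p := p) (w n)
      have := hM n
      rw [normPow_eq] at this
      change potPow p V (w n) ≤ M
      linarith
    · obtain ⟨C, hC⟩ := abs_rpow_split hp hε
      refine ⟨C, fun n x => ?_⟩
      rw [abs_mul, abs_of_nonneg (A.hV x)]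
      calc _ ≤ V x * (ε * |w n x| ^ p + C * |u x| ^ p) :=
            mul_le_mul_of_nonneg_left (hC _ _) (A.hV x)
        _ = _ := by ring
  · have := potPow_nonneg (p := p) A.hV (w n)
    have := hM n
    rw [normPow_eq, gradPow, tsum_mul_left] at this
    linarith
  · obtain ⟨C, hC⟩ := abs_rpow_split hp hε
    exact ⟨C, fun n d => hC _ _⟩

/-- Brezis–Lieb splitting for a superposition operator satisfying the splitting estimate. -/
lemma tendsto_tsum_split (A : Assumptions N p T V f)
    {h : (Fin N → ℤ) → ℝ → ℝ} (hc : ∀ x, Continuous (h x))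
    (h0 : ∀ x, h x 0 = 0) (hsum : ∀ u, InE p V u → Summable fun x => h x (u x))
    (hsplit : ∀ M, ∀ ε > 0, ∃ C, ∀ x a b, |a| ≤ M → |b| ≤ M →
      |h x (a + b) - h x a - h x b| ≤ ε * |a| ^ pStar N p + C * |b| ^ pStar N p)
    {w : ℕ → (Fin N → ℤ) → ℝ} {u : (Fin N → ℤ) → ℝ} {M : ℝ}
    (hw : ∀ n, InE p V (w n)) (hu : InE p V u) (hM : ∀ n, normPow p V (w n) ≤ M)
    (ht : ∀ x, Tendsto (fun n => w n x) atTop (𝓝 0)) :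
    Tendsto (fun n => ∑' x, h x ((w n + u) x) - ∑' x, h x (w n x) - ∑' x, h x (u x))
      atTop (𝓝 0) := by
  have hp := A.p_pos
  obtain ⟨B₁, -, hB₁⟩ := A.exists_sup_bound M
  obtain ⟨B₂, -, hB₂⟩ := A.exists_sup_bound (normPow p V u)
  obtain ⟨K, hK⟩ := A.exists_rpow_bound M
  have hsum' := fun n => hsum _ ((hw n).add hp.le A.hV hu).1
  have t := tendsto_tsum_of_almost_dominated
    (D := fun n x => h x ((w n + u) x) - h x (w n x) - h x (u x))
    (φ := fun n x => |w n x| ^ pStar N p) (K := K)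
    (fun _ _ => by positivity) (fun n => A.summable_rpow (hw n)) (fun n => hK _ (hw n) (hM n))
    (A.summable_rpow hu) (fun ε hε => ?_) (fun x => ?_)
  · refine t.congr fun n => ?_
    rw [((hsum' n).sub (hsum _ (hw n))).tsum_sub (hsum u hu), (hsum' n).tsum_sub (hsum _ (hw n))]
  · obtain ⟨C, hC⟩ := hsplit (max B₁ B₂) ε hε
    exact ⟨C, fun n x => hC x _ _ ((hB₁ _ (hw n) (hM n) x).trans (le_max_left _ _))
      ((hB₂ u hu le_rfl x).trans (le_max_right _ _))⟩
  · have h1 := ((hc x).tendsto (0 + u x)).comp ((ht x).add_const (u x))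
    have h2 := ((hc x).tendsto 0).comp (ht x)
    have := (h1.sub h2).sub_const (h x (u x))
    simpa [Function.comp_def, h0] using this

lemma shift_mem_nehari (A : Assumptions N p T V f)
    {u : (Fin N → ℤ) → ℝ} (hu : u ∈ nehari p V f) (k : Fin N → ℤ) :
    (fun x => u (x + (T : ℤ) • k)) ∈ nehari p V f ∧
      energy p V f (fun x => u (x + (T : ℤ) • k)) = energy p V f u ∧
      normPow p V (fun x => u (x + (T : ℤ) • k)) = normPow p V u := by
  set z := (T : ℤ) • k with hz
  have hV : ∀ x, V (x + z) = V x := A.hVper.smul_mem k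
  have hf : ∀ x, f (x + z) = f x := A.hfper.smul_mem k
  obtain ⟨hE, h0, hn⟩ := A.mem_nehari.1 hu
  have e1 : ∑' x, f x (u (x + z)) * u (x + z) = ∑' x, f x (u x) * u x := by
    rw [← (Equiv.addRight z).tsum_eq fun x => f x (u x) * u x]
    simp [hf]
  have e2 : ∑' x, primitive f x (u (x + z)) = ∑' x, primitive f x (u x) := by
    rw [← (Equiv.addRight z).tsum_eq fun x => primitive f x (u x)]
    simp [hf, primitive]
  refine ⟨A.mem_nehari.2 ⟨hE.shift hV, ?_, ?_⟩, ?_, normPow_shift u hV⟩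
  · obtain ⟨x, hx⟩ := Function.ne_iff.1 h0
    exact Function.ne_iff.2 ⟨x - z, by simpa using hx⟩
  · rw [nehariFn, normPow_shift u hV, e1]
    exact hn
  · rw [energy, normPow_shift u hV, e2, energy]

lemma nehari_nonempty (A : Assumptions N p T V f) : (nehari p V f).Nonempty := by
  have hfin : (Function.support (Pi.single 0 1 : (Fin N → ℤ) → ℝ)).Finite :=
    (Set.finite_singleton 0).subset Pi.support_single_subset
  obtain ⟨t, -, ht⟩ := A.exists_scale (InE.of_finite A.p_pos hfin)
    (by simp)
  exact ⟨_, ht⟩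

lemma nehariFn_zero (A : Assumptions N p T V f) : nehariFn p V f 0 = 0 := by
  simp [nehariFn, normPow, Real.zero_rpow A.p_pos.ne']

theorem exists_groundState (A : Assumptions N p T V f) : ∃ u, IsGroundState p V f u := by
  have hp := A.p_pos
  set S := energy p V f '' nehari p V f with hSdef
  have hbdd : BddBelow S := ⟨0, by rintro _ ⟨u, hu, rfl⟩; exact A.energy_nonneg hu⟩
  set c := sInf S with hc
  have hcle : ∀ u ∈ nehari p V f, c ≤ energy p V f u := fun u hu =>
    csInf_le hbdd ⟨u, hu, rfl⟩
  obtain ⟨e, hanti, he, hemem⟩ := exists_seq_tendsto_sInf (A.nehari_nonempty.image _) hbdd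
  choose u₁ hu₁ hu₁e using hemem
  obtain ⟨M, hM⟩ := A.exists_normPow_bound (e 0)
  obtain ⟨δ, hδ, hlow⟩ := A.exists_lower_bound M
  have hM₁ : ∀ n, normPow p V (u₁ n) ≤ M := fun n =>
    hM _ (hu₁ n) (by rw [hu₁e]; exact hanti (Nat.zero_le n))
  -- Translating a non-vanishing point into one fixed finite box keeps the mass from escaping to
  -- infinity.
  have hshift : ∀ n, ∃ v ∈ nehari p V f, energy p V f v = e n ∧ normPow p V v ≤ M ∧
      ∃ y ∈ Set.Icc (0 : Fin N → ℤ) (fun _ => (T : ℤ)), δ ≤ |v y| := by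
    intro n
    obtain ⟨x, hx⟩ := hlow _ (hu₁ n) (hM₁ n)
    obtain ⟨k, hk⟩ := exists_shift_mem_box A.hT x
    obtain ⟨h1, h2, h3⟩ := A.shift_mem_nehari (hu₁ n) (-k)
    refine ⟨_, h1, h2.trans (hu₁e n), h3.trans_le (hM₁ n), _, hk, ?_⟩
    simpa using hx
  choose v₀ hv₀ hv₀e hv₀M y hy hyv using hshift
  obtain ⟨B, hB0, hB⟩ := A.exists_sup_bound M
  -- Tychonoff's theorem on the countable product takes the place of weak compactness: only
  -- pointwise convergence is needed.
  have hcomp : IsCompact (Set.univ.pi fun _ : Fin N → ℤ => Set.Icc (-B) B) :=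
    isCompact_univ_pi fun _ => isCompact_Icc
  obtain ⟨u, -, φ, hφ, hlim⟩ := hcomp.tendsto_subseq (x := v₀) fun n x _ =>
    abs_le.1 (hB _ (A.mem_nehari.1 (hv₀ n)).1 (hv₀M n) x)
  have hlim' : ∀ x, Tendsto (fun n => v₀ (φ n) x) atTop (𝓝 (u x)) := tendsto_pi_nhds.1 hlim
  have hE : ∀ n, InE p V (v₀ (φ n)) := fun n => (A.mem_nehari.1 (hv₀ (φ n))).1
  have huE : InE p V u := InE.of_tendsto A.hp A.hpN A.hV hE
    (Eventually.of_forall fun n => hv₀M (φ n)) hlim'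
  have hfinbox := Set.finite_Icc (0 : Fin N → ℤ) (fun _ => (T : ℤ))
  have hu0 : u ≠ 0 := by
    rintro rfl
    have h1 : Tendsto (fun n => ∑ x ∈ hfinbox.toFinset, |v₀ (φ n) x|) atTop (𝓝 0) := by
      simpa using tendsto_finsetSum hfinbox.toFinset fun x _ => (hlim' x).abs
    refine absurd (ge_of_tendsto' h1 fun n => ?_) (not_le.2 hδ)
    exact (hyv (φ n)).trans (Finset.single_le_sum (f := fun x => |v₀ (φ n) x|)
      (fun _ _ => abs_nonneg _) (hfinbox.mem_toFinset.2 (hy (φ n))))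
  have heφ : Tendsto (fun n => ∑' x, gap p f x (v₀ (φ n) x)) atTop (𝓝 c) := by
    refine (he.comp hφ.tendsto_atTop).congr fun n => ?_
    rw [← A.energy_eq_gap (hv₀ (φ n)), hv₀e, Function.comp_apply]
  have hgap : ∑' x, gap p f x (u x) ≤ c := by
    refine le_of_forall_pos_le_add fun ε hε => ?_
    refine (tsum_le_of_tendsto (g := fun n x => gap p f x (v₀ (φ n) x))
      (fun n x => A.gap_nonneg x _) (fun n => A.summable_gap (hE n)) ?_
      (fun x => ((A.continuous_gap x).tendsto _).comp (hlim' x))).2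
    exact (heφ.eventually_lt_const (by linarith)).mono fun n hn => hn.le
  -- In the first case `u` scales down to a minimiser. The second is excluded by splitting off the
  -- remainder.
  rcases le_or_gt (nehariFn p V f u) 0 with hn | hn
  · obtain ⟨t, ht0, ht1, ht⟩ := A.exists_scale_le_one huE hu0 hn
    refine ⟨t • u, ht, fun v hv => le_trans ?_ (hcle v hv)⟩
    rw [A.energy_eq_gap ht]
    exact ((A.summable_gap (huE.smul t)).tsum_le_tsum
      (fun x => A.gap_scale_le x _ ht0.le ht1) (A.summable_gap huE)).trans hgap
  · exfalso
    set w : ℕ → (Fin N → ℤ) → ℝ := fun n => v₀ (φ n) - u with hw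
    have hwE : ∀ n, InE p V (w n) := fun n => ((hE n).sub hp.le A.hV huE).1
    have hwM : ∀ n, normPow p V (w n) ≤ 2 ^ p * (M + normPow p V u) := fun n =>
      ((hE n).sub hp.le A.hV huE).2.trans (by gcongr; exact hv₀M _)
    have hw0 : ∀ x, Tendsto (fun n => w n x) atTop (𝓝 0) := fun x => by
      simpa [hw] using (hlim' x).sub_const (u x)
    have hwu : ∀ n, w n + u = v₀ (φ n) := fun n => sub_add_cancel _ _
    have s1 := A.tendsto_normPow_split hwE huE hwM hw0
    have s2 := A.tendsto_tsum_split A.continuous_mul (fun x => mul_zero _)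
      (fun u hu => A.summable_f_mul hu) (fun M ε hε => A.split_f_mul M hε) hwE huE hwM hw0
    have s3 := A.tendsto_tsum_split A.continuous_gap (gap_zero p f)
      (fun u hu => A.summable_gap hu) (fun M ε hε => A.split_gap M hε) hwE huE hwM hw0
    simp only [hwu] at s1 s2 s3
    have l1 : Tendsto (fun n => nehariFn p V f (w n)) atTop (𝓝 (-nehariFn p V f u)) := by
      have := ((s1.sub s2).neg).sub_const (nehariFn p V f u)
      simp only [sub_zero, neg_zero, zero_sub] at this
      refine this.congr fun n => ?_
      have h0 := (A.mem_nehari.1 (hv₀ (φ n))).2.2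
      simp only [nehariFn] at h0 ⊢
      linarith
    have l2 : Tendsto (fun n => ∑' x, gap p f x (w n x)) atTop
        (𝓝 (c - ∑' x, gap p f x (u x))) := by
      have := (heφ.sub s3).sub_const (∑' x, gap p f x (u x))
      rw [sub_zero] at this
      refine this.congr fun n => ?_
      ring
    have hpos : 0 < ∑' x, gap p f x (u x) := by
      obtain ⟨x, hx⟩ := Function.ne_iff.1 hu0
      exact (A.summable_gap huE).tsum_pos (fun x => A.gap_nonneg x _) x (A.gap_pos x hx)
    -- The remainder has negative Nehari functional and `∑ G < c`, so its projection to the manifold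
    -- would have energy below `c`.
    obtain ⟨n, hn1, hn2⟩ := ((l1.eventually_lt_const (neg_lt_zero.2 hn)).and
      (l2.eventually_lt_const (sub_lt_self c hpos))).exists
    have hwn0 : w n ≠ 0 := fun h => by
      rw [h, A.nehariFn_zero] at hn1
      exact lt_irrefl _ hn1
    obtain ⟨t, ht0, ht1, ht⟩ := A.exists_scale_le_one (hwE n) hwn0 hn1.le
    have h1 := hcle _ ht
    rw [A.energy_eq_gap ht] at h1
    have h2 := (A.summable_gap ((hwE n).smul t)).tsum_le_tsum
      (fun x => A.gap_scale_le x (w n x) ht0.le ht1) (A.summable_gap (hwE n))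
    exact absurd (h1.trans h2) (not_le.2 hn2)

end Assumptions

/-! ### Perturbation at one vertex: ground states solve the equation. -/

noncomputable instance {N : ℕ} (x : Fin N → ℤ) : Fintype ((lattice N).neighborSet x) :=
  (neighborSet_finite x).fintype

/-- A sum over darts of a symmetric function supported on the darts at `x₀` is twice the sum over
the neighbours of `x₀`. -/
lemma tsum_dart_eq {N : ℕ} (x₀ : Fin N → ℤ) (g : (lattice N).Dart → ℝ)
    (hsymm : ∀ d, g d.symm = g d) (hsupp : ∀ d, d.fst ≠ x₀ → d.snd ≠ x₀ → g d = 0) :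
    ∑' d, g d = 2 * ∑ y : (lattice N).neighborSet x₀, g ((lattice N).dartOfNeighborSet x₀ y) := by
  set g₁ : (lattice N).Dart → ℝ := Set.indicator {d | d.fst = x₀} g with hg₁
  have hin : ∀ d : (lattice N).Dart, d.fst = x₀ → g₁ d = g d := fun d hd =>
    Set.indicator_of_mem (s := {d : (lattice N).Dart | d.fst = x₀}) hd g
  have hout : ∀ d : (lattice N).Dart, d.fst ≠ x₀ → g₁ d = 0 := fun d hd =>
    Set.indicator_of_notMem (s := {d : (lattice N).Dart | d.fst = x₀}) hd g
  have hfin : Summable g₁ := by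
    refine summable_of_hasFiniteSupport ((darts_fst_finite (Set.finite_singleton x₀)).subset ?_)
    intro d hd
    by_contra h
    exact hd (hout d h)
  have hinv : Function.Involutive (SimpleGraph.Dart.symm (G := lattice N)) :=
    SimpleGraph.Dart.symm_involutive
  -- Since there are no loops, at most one endpoint of a dart is `x₀`, so at most one of the two
  -- summands is present.
  have hdec : ∀ d, g d = g₁ d + g₁ d.symm := by
    intro d
    have hfs : d.symm.fst = d.snd := rfl
    by_cases h1 : d.fst = x₀
    · have h2 : d.symm.fst ≠ x₀ := fun h2 => d.adj.ne (h1.trans (hfs ▸ h2).symm)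
      rw [hin d h1, hout _ h2, add_zero]
    · by_cases h2 : d.snd = x₀
      · rw [hout d h1, hin d.symm h2, hsymm, zero_add]
      · rw [hout d h1, hout d.symm h2, hsupp d h1 h2, add_zero]
  have e1 : ∑' d, g₁ (SimpleGraph.Dart.symm d) = ∑' d, g₁ d :=
    Equiv.tsum_eq (Function.Involutive.toPerm _ hinv) g₁
  have s2 : Summable fun d => g₁ (SimpleGraph.Dart.symm d) :=
    (Equiv.summable_iff (Function.Involutive.toPerm _ hinv)).2 hfin
  have hrange : Function.support g₁ ⊆ Set.range ((lattice N).dartOfNeighborSet x₀) := by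
    intro d hd
    have h1 : d.fst = x₀ := by
      by_contra h
      exact hd (hout d h)
    subst h1
    exact ⟨⟨d.snd, d.adj⟩, rfl⟩
  have e2 : ∑' d, g₁ d = ∑' y, g₁ ((lattice N).dartOfNeighborSet x₀ y) :=
    (Function.Injective.tsum_eq ((lattice N).dartOfNeighborSet_injective x₀) hrange).symm
  rw [tsum_congr hdec, hfin.tsum_add s2, e1, e2, tsum_fintype, ← two_mul]
  congr 1
  exact Finset.sum_congr rfl fun y _ => hin _ rfl

/-- The part of `‖w‖ ^ p` that involves the vertex `x₀`, as a function of the value at `x₀`. -/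
noncomputable def localPow {N : ℕ} (p : ℝ) (V w : (Fin N → ℤ) → ℝ) (x₀ : Fin N → ℤ) (t : ℝ) : ℝ :=
  ∑ y : (lattice N).neighborSet x₀, |w y - t| ^ p + V x₀ * |t| ^ p

/-- The residual of the equation at `x₀` when the value at `x₀` is replaced by `t`. -/
noncomputable def residual {N : ℕ} (p : ℝ) (V : (Fin N → ℤ) → ℝ) (f : (Fin N → ℤ) → ℝ → ℝ)
    (w : (Fin N → ℤ) → ℝ) (x₀ : Fin N → ℤ) (t : ℝ) : ℝ :=
  -(∑ y : (lattice N).neighborSet x₀, |w y - t| ^ (p - 2) * (w y - t))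
    + V x₀ * (|t| ^ (p - 2) * t) - f x₀ t

lemma support_single_finite {N : ℕ} (x₀ : Fin N → ℤ) (s : ℝ) :
    (Function.support (Pi.single x₀ s : (Fin N → ℤ) → ℝ)).Finite :=
  (Set.finite_singleton x₀).subset Pi.support_single_subset

lemma tsum_add_single {N : ℕ} (h : (Fin N → ℤ) → ℝ → ℝ) (w : (Fin N → ℤ) → ℝ)
    (x₀ : Fin N → ℤ) (s : ℝ) (h1 : Summable fun x => h x ((w + Pi.single x₀ s : (Fin N → ℤ) → ℝ) x))
    (h2 : Summable fun x => h x (w x)) :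
    ∑' x, h x ((w + Pi.single x₀ s : (Fin N → ℤ) → ℝ) x) = ∑' x, h x (w x) + (h x₀ (w x₀ + s) - h x₀ (w x₀)) := by
  rw [← sub_eq_iff_eq_add', ← h1.tsum_sub h2, tsum_eq_single x₀]
  · simp
  · intro x hx
    simp [hx]

/-- Each edge at `x₀` gives two darts, which cancels the weight `1 / 2`; hence `localPow` carries
none. -/
lemma normPow_add_single {N : ℕ} {p : ℝ} (hp : 0 < p) {V : (Fin N → ℤ) → ℝ}
    (hV : ∀ x, 0 ≤ V x) {w : (Fin N → ℤ) → ℝ} (hw : InE p V w) (x₀ : Fin N → ℤ) (s : ℝ) :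
    normPow p V (w + Pi.single x₀ s) =
      normPow p V w + (localPow p V w x₀ (w x₀ + s) - localPow p V w x₀ (w x₀)) := by
  have hw' : InE p V (w + Pi.single x₀ s) :=
    (hw.add hp.le hV (InE.of_finite hp (support_single_finite x₀ s))).1
  have e1 : gradPow p (w + Pi.single x₀ s) = gradPow p w +
      ∑ y : (lattice N).neighborSet x₀, (|w y - (w x₀ + s)| ^ p - |w y - w x₀| ^ p) := by
    rw [← sub_eq_iff_eq_add', gradPow, gradPow,
      ← (hw'.grad.mul_left (1 / 2)).tsum_sub (hw.grad.mul_left (1 / 2)),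
      tsum_dart_eq x₀, Finset.mul_sum]
    · refine Finset.sum_congr rfl fun y _ => ?_
      have hy : (y : Fin N → ℤ) ≠ x₀ := fun h => (lattice N).ne_of_adj y.2 h.symm
      simp only [SimpleGraph.dartOfNeighborSet, Pi.add_apply, Pi.single_eq_same,
        Pi.single_eq_of_ne hy, add_zero]
      ring
    · intro d
      have h1 : d.symm.fst = d.snd := rfl
      have h2 : d.symm.snd = d.fst := rfl
      rw [h1, h2, abs_sub_comm, abs_sub_comm (w d.fst)]
    · intro d h1 h2
      simp [h1, h2]
  have e2 := tsum_add_single (fun x t => V x * |t| ^ p) w x₀ s hw'.pot hw.pot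
  rw [normPow_eq, e1, potPow, e2, normPow_eq, potPow, localPow, localPow,
    Finset.sum_sub_distrib]
  ring

/-- For `p < 2` the first factor is singular at `0`. Continuity follows because the product is, up
to the factor `p`, the derivative of the `C¹` function `|t| ^ p`. -/
lemma continuous_abs_rpow_sub_two_mul {p : ℝ} (hp : 1 < p) :
    Continuous fun t : ℝ => |t| ^ (p - 2) * t := by
  have h1 : ContDiff ℝ 1 fun t : ℝ => ‖t‖ ^ p := contDiff_norm_rpow hp
  have h2 := h1.continuous_deriv le_rfl
  have h3 : deriv (fun t : ℝ => ‖t‖ ^ p) = fun t => p * (|t| ^ (p - 2) * t) := by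
    ext t
    rw [(hasDerivAt_norm_rpow t hp).deriv, Real.norm_eq_abs, mul_assoc]
  rw [h3] at h2
  have hp0 : p ≠ 0 := by linarith
  simpa [hp0] using h2.const_mul p⁻¹

lemma pLaplacian_eq_sum {N : ℕ} (p : ℝ) (u : (Fin N → ℤ) → ℝ) (x : Fin N → ℤ) :
    pLaplacian p u x =
      ∑ y : (lattice N).neighborSet x, |u y - u x| ^ (p - 2) * (u y - u x) :=
  tsum_fintype _

/-- A property that propagates along edges and holds somewhere holds everywhere. -/
lemma forall_of_adj {N : ℕ} {P : (Fin N → ℤ) → Prop} (h : ∀ x y, (lattice N).Adj x y → P x → P y)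
    {x₀ : Fin N → ℤ} (hx₀ : P x₀) (x : Fin N → ℤ) : P x := by
  -- Propagation along unit steps in both directions is periodicity with period one, so every
  -- lattice vector is a period.
  have hper : IsPeriodic 1 P := fun x i => propext
    ⟨h _ _ (coordDart i x).adj.symm, h _ _ (coordDart i x).adj⟩
  have := hper.smul_mem (x - x₀) x₀
  rw [Nat.cast_one, one_smul, add_sub_cancel] at this
  exact this ▸ hx₀

namespace Assumptions

variable {N : ℕ} {p : ℝ} {T : ℕ} {V : (Fin N → ℤ) → ℝ} {f : (Fin N → ℤ) → ℝ → ℝ}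

lemma continuous_localPow (A : Assumptions N p T V f) (u : (Fin N → ℤ) → ℝ) (x₀ : Fin N → ℤ) :
    Continuous fun z : ℝ × ℝ => localPow p V (z.1 • u) x₀ z.2 := by
  have hr : Continuous fun t : ℝ => |t| ^ p :=
    continuous_abs.rpow_const fun _ => Or.inr A.p_pos.le
  refine (continuous_finsetSum _ fun y _ => ?_).add (continuous_const.mul (hr.comp continuous_snd))
  exact hr.comp ((continuous_fst.mul continuous_const).sub continuous_snd)

lemma continuous_residual (A : Assumptions N p T V f) (u : (Fin N → ℤ) → ℝ) (x₀ : Fin N → ℤ) :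
    Continuous fun z : ℝ × ℝ => residual p V f (z.1 • u) x₀ z.2 := by
  have hr := continuous_abs_rpow_sub_two_mul A.hp
  refine ((continuous_finsetSum _ fun y _ => ?_).neg.add
    (continuous_const.mul (hr.comp continuous_snd))).sub ((A.hfcont x₀).comp continuous_snd)
  exact hr.comp ((continuous_fst.mul continuous_const).sub continuous_snd)

/-- The equation at `x₀` is thus criticality of `Φ` with respect to the single value `u x₀`. -/
lemma hasDerivAt_localEnergy (A : Assumptions N p T V f)
    (w : (Fin N → ℤ) → ℝ) (x₀ : Fin N → ℤ) (t : ℝ) :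
    HasDerivAt (fun t => 1 / p * localPow p V w x₀ t - primitive f x₀ t)
      (residual p V f w x₀ t) t := by
  have hp := A.p_pos
  have h1 : ∀ y : (lattice N).neighborSet x₀, HasDerivAt (fun t => |w y - t| ^ p)
      (p * |w y - t| ^ (p - 2) * (w y - t) * (0 - 1)) t := fun y =>
    (hasDerivAt_abs_rpow (w y - t) A.hp).comp t ((hasDerivAt_const t (w y)).sub (hasDerivAt_id t))
  have h2 := ((HasDerivAt.fun_sum fun y (_ : y ∈ Finset.univ) => h1 y).add
    ((hasDerivAt_abs_rpow t A.hp).const_mul (V x₀))).const_mul (1 / p)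
  refine (h2.sub (A.hasDerivAt_primitive x₀ t)).congr_deriv (Eq.symm ?_)
  rw [residual, mul_add, Finset.mul_sum, ← Finset.sum_neg_distrib]
  congr 2
  · refine Finset.sum_congr rfl fun y _ => ?_
    field_simp
    ring
  · field_simp

lemma nehariFn_add_single (A : Assumptions N p T V f)
    {w : (Fin N → ℤ) → ℝ} (hw : InE p V w) (x₀ : Fin N → ℤ) (s : ℝ) :
    nehariFn p V f (w + Pi.single x₀ s) = nehariFn p V f w +
      (localPow p V w x₀ (w x₀ + s) - localPow p V w x₀ (w x₀)
        - (f x₀ (w x₀ + s) * (w x₀ + s) - f x₀ (w x₀) * w x₀)) := by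
  have hw' : InE p V (w + Pi.single x₀ s) :=
    (hw.add A.p_pos.le A.hV (InE.of_finite A.p_pos (support_single_finite x₀ s))).1
  rw [nehariFn, nehariFn, normPow_add_single A.p_pos A.hV hw,
    tsum_add_single (fun x t => f x t * t) w x₀ s (A.summable_f_mul hw') (A.summable_f_mul hw)]
  ring

lemma energy_add_single (A : Assumptions N p T V f)
    {w : (Fin N → ℤ) → ℝ} (hw : InE p V w) (x₀ : Fin N → ℤ) (s : ℝ) :
    energy p V f (w + Pi.single x₀ s) = energy p V f w +
      ((1 / p * localPow p V w x₀ (w x₀ + s) - primitive f x₀ (w x₀ + s)) -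
        (1 / p * localPow p V w x₀ (w x₀) - primitive f x₀ (w x₀))) := by
  have hw' : InE p V (w + Pi.single x₀ s) :=
    (hw.add A.p_pos.le A.hV (InE.of_finite A.p_pos (support_single_finite x₀ s))).1
  rw [energy, energy, normPow_add_single A.p_pos A.hV hw,
    tsum_add_single (primitive f) w x₀ s (A.summable_primitive hw') (A.summable_primitive hw)]
  ring

/-- The residual of a ground state vanishes at every vertex. -/
lemma residual_eq_zero (A : Assumptions N p T V f)
    {u : (Fin N → ℤ) → ℝ} (hu : IsGroundState p V f u) (x₀ : Fin N → ℤ) :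
    residual p V f u x₀ (u x₀) = 0 := by
  by_contra hres
  obtain ⟨hE, h0, -⟩ := A.mem_nehari.1 hu.1
  set r := residual p V f u x₀ (u x₀) with hr
  have hsm : ∀ t : ℝ, InE p V (t • u) := fun t => hE.smul t
  -- the residual keeps its sign near `(1, 0)`
  have hcont : Continuous fun z : ℝ × ℝ =>
      residual p V f (z.1 • u) x₀ (z.1 * u x₀ + z.2) * r :=
    ((A.continuous_residual u x₀).comp (continuous_fst.prodMk
      ((continuous_fst.mul continuous_const).add continuous_snd))).mul continuous_const
  have hpos : ∀ᶠ z in 𝓝 ((1 : ℝ), (0 : ℝ)),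
      0 < residual p V f (z.1 • u) x₀ (z.1 * u x₀ + z.2) * r := by
    refine (hcont.tendsto _).eventually_const_lt ?_
    simp only [one_smul, one_mul, add_zero, ← hr]
    exact mul_self_pos.2 hres
  obtain ⟨η₀, hη₀, hball⟩ := Metric.eventually_nhds_iff.1 hpos
  set η := min (η₀ / 2) (1 / 2) with hη
  have hη0 : 0 < η := by positivity
  have hη1 : η ≤ 1 / 2 := min_le_right _ _
  have hη2 : η < η₀ := (min_le_left _ _).trans_lt (half_lt_self hη₀)
  have hnear : ∀ t s : ℝ, |t - 1| ≤ η → |s| ≤ η →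
      0 < residual p V f (t • u) x₀ (t * u x₀ + s) * r := fun t s ht hs =>
    hball (y := (t, s)) (by
      rw [Prod.dist_eq, max_lt_iff, Real.dist_eq, Real.dist_eq, sub_zero]
      exact ⟨ht.trans_lt hη2, hs.trans_lt hη2⟩)
  have hqc : Continuous fun z : ℝ × ℝ => localPow p V (z.1 • u) x₀ (z.1 * u x₀ + z.2) -
      localPow p V (z.1 • u) x₀ (z.1 * u x₀) - (f x₀ (z.1 * u x₀ + z.2) * (z.1 * u x₀ + z.2)
        - f x₀ (z.1 * u x₀) * (z.1 * u x₀)) := by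
    have c1 : Continuous fun z : ℝ × ℝ => z.1 * u x₀ := continuous_fst.mul continuous_const
    have c2 : Continuous fun z : ℝ × ℝ => z.1 * u x₀ + z.2 := c1.add continuous_snd
    exact (((A.continuous_localPow u x₀).comp (continuous_fst.prodMk c2)).sub
      ((A.continuous_localPow u x₀).comp (continuous_fst.prodMk c1))).sub
      (((A.continuous_mul x₀).comp c2).sub ((A.continuous_mul x₀).comp c1))
  have hlim : ∀ t : ℝ, Tendsto (fun s : ℝ => nehariFn p V f (t • u + Pi.single x₀ s)) (𝓝 0)
      (𝓝 (nehariFn p V f (t • u))) := by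
    intro t
    simp only [A.nehariFn_add_single (hsm t), Pi.smul_apply, smul_eq_mul]
    have := ((hqc.comp (Continuous.prodMk_right t)).tendsto 0).const_add
      (nehariFn p V f (t • u))
    simpa [Function.comp_def] using this
  obtain ⟨x₁, hx₁⟩ := Function.ne_iff.1 h0
  have hx₁' : 0 < |u x₁| / 2 := half_pos (abs_pos.2 hx₁)
  have ev1 := (hlim (1 - η)).eventually_const_lt
    (A.nehariFn_smul_pos hu.1 (by linarith) (by linarith))
  have ev2 := (hlim (1 + η)).eventually_lt_const (A.nehariFn_smul_neg hu.1 (by linarith))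
  -- As `t ≥ 1 / 2` below, the second bound prevents the perturbation from cancelling `t u` at `x₁`.
  have ev3 : ∀ᶠ s in 𝓝 (0 : ℝ), |s| ≤ η ∧ |s| < |u x₁| / 2 := by
    have ht : Tendsto (fun s : ℝ => |s|) (𝓝 0) (𝓝 0) := by
      simpa using (continuous_abs (G := ℝ)).tendsto 0
    exact ((ht.eventually_lt_const hη0).mono fun s hs => hs.le).and (ht.eventually_lt_const hx₁')
  -- Moving the value at `x₀` against the sign of the residual lowers the energy.
  have hdir : Tendsto (fun h : ℝ => -r * h) (𝓝[>] 0) (𝓝 0) := by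
    have : Tendsto (fun h : ℝ => -r * h) (𝓝 0) (𝓝 (-r * 0)) := tendsto_id.const_mul _
    rw [mul_zero] at this
    exact this.mono_left nhdsWithin_le_nhds
  obtain ⟨h, ⟨⟨hs1, hs2⟩, hs3, hs4⟩, hh⟩ :=
    ((hdir.eventually ((ev1.and ev2).and ev3)).and self_mem_nhdsWithin).exists
  have hh0 : 0 < h := hh
  set s := -r * h with hs
  -- a point of the Nehari manifold on the perturbed segment
  have hcon : ContinuousOn (fun t : ℝ => nehariFn p V f (t • u + Pi.single x₀ s))
      (Set.Icc (1 - η) (1 + η)) := by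
    simp only [A.nehariFn_add_single (hsm _), Pi.smul_apply, smul_eq_mul]
    refine ((A.continuousOn_nehariFn_smul hE 2).mono ?_).add
      (hqc.comp (Continuous.prodMk_left s)).continuousOn
    exact Set.Icc_subset_Icc (by linarith) (by linarith)
  -- The Nehari functional is positive just below `t = 1` and negative just above, and a small
  -- perturbation preserves both signs.
  obtain ⟨t, ht, hte⟩ := intermediate_value_Icc' (by linarith : 1 - η ≤ 1 + η) hcon
    (show (0 : ℝ) ∈ _ from ⟨hs2.le, hs1.le⟩)
  have ht1 : |t - 1| ≤ η := abs_le.2 ⟨by linarith [ht.1], by linarith [ht.2]⟩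
  have ht0 : 1 / 2 ≤ t := by linarith [ht.1]
  have hne : t • u + Pi.single x₀ s ≠ 0 := by
    refine Function.ne_iff.2 ⟨x₁, fun hz => ?_⟩
    by_cases hx : x₁ = x₀
    · subst hx
      simp only [Pi.add_apply, Pi.smul_apply, smul_eq_mul, Pi.single_eq_same, Pi.zero_apply] at hz
      have : |s| = t * |u x₁| := by
        rw [← abs_of_nonneg (by linarith : 0 ≤ t), ← abs_mul, ← abs_neg s]
        congr 1; linarith
      nlinarith
    · simp only [Pi.add_apply, Pi.smul_apply, smul_eq_mul, Pi.single_eq_of_ne hx, Pi.zero_apply,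
        add_zero] at hz
      exact (mul_ne_zero (by linarith) hx₁) hz
  have hmem : t • u + Pi.single x₀ s ∈ nehari p V f := A.mem_nehari.2
    ⟨((hsm t).add A.p_pos.le A.hV (InE.of_finite A.p_pos (support_single_finite x₀ s))).1, hne, hte⟩
  -- its energy is strictly smaller
  have hderiv : ∀ θ : ℝ, HasDerivAt (fun θ : ℝ =>
      1 / p * localPow p V (t • u) x₀ (t * u x₀ + θ * s) - primitive f x₀ (t * u x₀ + θ * s))
      (residual p V f (t • u) x₀ (t * u x₀ + θ * s) * s) θ := fun θ => by
    have hi : HasDerivAt (fun θ : ℝ => t * u x₀ + θ * s) s θ := by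
      simpa using ((hasDerivAt_id θ).mul_const s).const_add (t * u x₀)
    exact (A.hasDerivAt_localEnergy (t • u) x₀ (t * u x₀ + θ * s)).comp θ hi
  obtain ⟨θ, hθ, hθe⟩ := exists_hasDerivAt_eq_slope _ _ (zero_lt_one (α := ℝ))
    (fun θ _ => (hderiv θ).continuousAt.continuousWithinAt) (fun θ _ => hderiv θ)
  have hθs : |θ * s| ≤ η := by
    rw [abs_mul, abs_of_pos hθ.1]
    nlinarith [abs_nonneg s, hθ.2]
  have hneg : residual p V f (t • u) x₀ (t * u x₀ + θ * s) * s < 0 := by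
    have := mul_pos (hnear t (θ * s) ht1 hθs) hh0
    rw [hs]
    rw [hs] at this
    linarith
  rw [hθe] at hneg
  simp only [one_mul, zero_mul, add_zero, sub_zero, div_one] at hneg
  have h1 := A.energy_add_single (hsm t) x₀ s
  simp only [Pi.smul_apply, smul_eq_mul] at h1
  have h2 := A.energy_smul_le hu.1 (by linarith : 0 ≤ t)
  have h3 := hu.2 _ hmem
  linarith

theorem isSolution_of_isGroundState (A : Assumptions N p T V f)
    {u : (Fin N → ℤ) → ℝ} (hu : IsGroundState p V f u) :
    IsSolution p V f u := by
  refine ⟨hu.1.1, fun x => ?_⟩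
  have := A.residual_eq_zero hu x
  rw [residual] at this
  rw [pLaplacian_eq_sum]
  linarith

/-! ### Sign of ground states. -/

/-- If `F (x, t) ≤ F (x, |t|)`, the absolute value of a ground state is a ground state with the
same norm. -/
lemma isGroundState_abs (A : Assumptions N p T V f)
    (hF : ∀ x t, primitive f x t ≤ primitive f x |t|)
    {u : (Fin N → ℤ) → ℝ} (hu : IsGroundState p V f u) :
    IsGroundState p V f (fun x => |u x|) ∧ gradPow p (fun x => |u x|) = gradPow p u := by
  have hp := A.p_pos
  obtain ⟨hE, h0, -⟩ := A.mem_nehari.1 hu.1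
  obtain ⟨haE, hgrad, hpot⟩ := hE.of_le hp.le A.hV (w := fun x => |u x|)
    (fun _ _ => abs_abs_sub_abs_le _ _) fun _ => (abs_abs _).le
  have ha0 : (fun x => |u x|) ≠ 0 := fun h => h0 (by
    ext x
    simpa using congrFun h x)
  obtain ⟨t, ht, hmem⟩ := A.exists_scale haE ha0
  have hsum : ∑' x, primitive f x ((t • u) x) ≤
      ∑' x, primitive f x ((t • fun x => |u x|) x) := by
    refine (A.summable_primitive (hE.smul t)).tsum_le_tsum (fun x => ?_)
      (A.summable_primitive (haE.smul t))
    simpa [abs_mul, abs_of_pos ht] using hF x (t * u x)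
  have htp : 0 < t ^ p := by positivity
  have hle : energy p V f (t • fun x => |u x|) + 1 / p * (t ^ p * (gradPow p u -
      gradPow p fun x => |u x|)) ≤ energy p V f (t • u) := by
    rw [energy, energy, normPow_smul, normPow_smul, abs_of_pos ht, normPow_eq, normPow_eq]
    have : 1 / p * (t ^ p * potPow p V fun x => |u x|) ≤ 1 / p * (t ^ p * potPow p V u) := by
      gcongr
    linarith
  have hdiff : 0 ≤ 1 / p * (t ^ p * (gradPow p u - gradPow p fun x => |u x|)) :=
    mul_nonneg (by positivity) (mul_nonneg htp.le (sub_nonneg.2 hgrad))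
  have hmin := hu.2 _ hmem
  -- In the chain `Φ (u) ≤ Φ (t |u|) ≤ Φ (t u) ≤ Φ (u)` the last inequality is strict unless `t =
  -- 1`. Equality throughout also forces equal gradient energies.
  have ht1 : t = 1 := by
    by_contra h
    have := A.energy_smul_lt hu.1 ht.le h
    linarith
  subst ht1
  rw [one_smul] at hmem hmin
  simp only [one_smul] at hle
  refine ⟨⟨hmem, fun v hv => le_trans ?_ (hu.2 v hv)⟩, le_antisymm hgrad ?_⟩
  · linarith
  · have h1 : 1 / p * (1 ^ p * (gradPow p u - gradPow p fun x => |u x|)) ≤ 0 := by linarith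
    rw [Real.one_rpow, one_mul] at h1
    have := nonpos_of_mul_nonpos_right h1 (by positivity : 0 < 1 / p)
    linarith

/-- At a zero of `|u|` the equation reduces to a vanishing sum of nonnegative terms over the
neighbours, so zeros spread along edges and `u` would vanish identically. -/
lemma abs_pos_of_isGroundState (A : Assumptions N p T V f) {u : (Fin N → ℤ) → ℝ}
    (hu : IsGroundState p V f (fun x => |u x|)) (x : Fin N → ℤ) : 0 < |u x| := by
  rcases (abs_nonneg (u x)).eq_or_lt with hx | hx
  swap
  · exact hx
  exfalso
  refine hu.1.2.1 (funext fun y => ?_)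
  refine forall_of_adj (P := fun x => |u x| = 0) (fun a b hab ha => ?_) hx.symm y
  have hsol := (A.isSolution_of_isGroundState hu).2 a
  rw [pLaplacian_eq_sum] at hsol
  simp only [ha, A.f_zero, sub_zero, mul_zero, add_zero, neg_eq_zero, abs_abs] at hsol
  have hb := (Finset.sum_eq_zero_iff_of_nonneg (fun y _ => by positivity)).1 hsol
    ⟨b, hab⟩ (Finset.mem_univ _)
  by_contra hne
  have hb0 : 0 < |u b| := (abs_nonneg _).lt_of_ne (Ne.symm hne)
  have : 0 < |u b| ^ (p - 2) * |u b| := by positivity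
  exact this.ne' hb

theorem pos_or_neg_of_isGroundState (A : Assumptions N p T V f)
    (hF : ∀ x t, primitive f x t ≤ primitive f x |t|)
    {u : (Fin N → ℤ) → ℝ} (hu : IsGroundState p V f u) : (∀ x, 0 < u x) ∨ ∀ x, u x < 0 := by
  have hp := A.p_pos
  obtain ⟨habs, hgrad⟩ := A.isGroundState_abs hF hu
  have hne : ∀ x, u x ≠ 0 := fun x => abs_pos.1 (A.abs_pos_of_isGroundState habs x)
  have hE := (A.mem_nehari.1 hu.1).1
  have haE := (A.mem_nehari.1 habs.1).1
  have hsame : ∀ x y, (lattice N).Adj x y → 0 < u x * u y := by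
    intro x y hxy
    by_contra! h
    have hlt : u x * u y < 0 := lt_of_le_of_ne h (mul_ne_zero (hne x) (hne y))
    -- A sign change across one edge strictly lowers the gradient energy on passing to `|u|`,
    -- against the equality `hgrad`.
    have hstrict : abs (|u y| - |u x|) < |u y - u x| := by
      rw [← sq_lt_sq]
      have h1 : |u y| * |u x| = -(u x * u y) := by
        rw [← abs_mul, mul_comm, abs_of_neg hlt]
      nlinarith [sq_abs (u x), sq_abs (u y)]
    have hle : ∀ d : (lattice N).Dart, 1 / 2 * abs (|u d.snd| - |u d.fst|) ^ p ≤
        1 / 2 * |u d.snd - u d.fst| ^ p := fun d =>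
      mul_le_mul_of_nonneg_left (Real.rpow_le_rpow (abs_nonneg _) (abs_abs_sub_abs_le _ _) hp.le)
        (by norm_num)
    have := (haE.grad.mul_left (1 / 2)).tsum_lt_tsum (i := ⟨(x, y), hxy⟩) hle
      (mul_lt_mul_of_pos_left (Real.rpow_lt_rpow (abs_nonneg _) hstrict hp) (by norm_num))
      (hE.grad.mul_left (1 / 2))
    exact this.ne hgrad
  rcases lt_or_gt_of_ne (hne 0) with h | h
  · exact Or.inr (forall_of_adj (P := fun x => u x < 0)
      (fun x y hxy hx => by nlinarith [hsame x y hxy]) h)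
  · exact Or.inl (forall_of_adj (P := fun x => 0 < u x)
      (fun x y hxy hx => pos_of_mul_pos_right (hsame x y hxy) hx.le) h)

end Assumptions

end LatticePLaplace

theorem theorem1p1 (N : ℕ) (p : ℝ) (hp : 1 < p) (hpN : p < N)
    (T : ℕ) (hT : 0 < T)
    (V : (Fin N → ℤ) → ℝ) (f : (Fin N → ℤ) → ℝ → ℝ)
    -- (S1)
    (hVper : LatticePLaplace.IsPeriodic T V) (hfper : LatticePLaplace.IsPeriodic T f)
    (hV : ∀ x, 0 ≤ V x)
    -- (S2)
    (hfcont : ∀ x, Continuous (f x))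
    (hgrowth : ∃ a > 0, ∃ q > LatticePLaplace.pStar N p,
      ∀ x t, f x t ≤ a * (1 + |t| ^ (q - 1)))
    -- (S3)
    (hzero : ∀ ε > 0, ∃ δ > 0, ∀ x t, 0 < |t| → |t| < δ →
      |f x t| ≤ ε * |t| ^ (LatticePLaplace.pStar N p - 1))
    -- (S4)
    (hmono : ∀ x, StrictMonoOn (fun t : ℝ => f x t / |t| ^ (p - 1)) (Set.Iio 0 ∪ Set.Ioi 0))
    -- (S5)
    (hsuper : ∀ M : ℝ, ∃ R > 0, ∀ x t, R < |t| →
      M ≤ LatticePLaplace.primitive f x t / |t| ^ p) :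
    (∃ u, LatticePLaplace.IsGroundState p V f u) ∧
    (∀ u, LatticePLaplace.IsGroundState p V f u → LatticePLaplace.IsSolution p V f u) ∧
    ((∀ x t, LatticePLaplace.primitive f x t ≤ LatticePLaplace.primitive f x |t|) →
      ∀ u, LatticePLaplace.IsGroundState p V f u → (∀ x, 0 < u x) ∨ (∀ x, u x < 0)) := by
  have A : LatticePLaplace.Assumptions N p T V f :=
    ⟨hp, hpN, hT, hVper, hfper, hV, hfcont, hzero, hmono, hsuper⟩
  exact ⟨A.exists_groundState, fun _ hu => A.isSolution_of_isGroundState hu,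
    fun hF _ hu => A.pos_or_neg_of_isGroundState hF hu⟩
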